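/- Let $n\ge 0$, let $M$ be an orientable smooth manifold (without boundary, Hausdorff, second countable) of dimension $2n+1$, and let $W=M\times\mathbb{R}$. All tensors, metrics and connections below are smooth. For a Riemannian metric $g$ on a manifold $N$, the dual of an affine connection $\nabla$ on $N$ is the affine connection $\nabla^*$ with $Z\,g(X,Y)=g(\nabla_ZX,Y)+g(X,\nabla^*_ZY)$ for all vector fields $X,Y,Z$; $\nabla$ is self-dual (with respect to $g$) if $\nabla^*=\nabla$. No condition is imposed on the torsion. A $(1,1)$-tensor $\theta$ solves the gauge equation of $(\nabla,\nabla^*)$ if $\nabla^*_X(\theta Y)=\theta(\nabla_XY)$ for all vector fields $X,Y$. We say that the gauge equation of self-dual connections on $N$ admits a skew-symmetric solution of rank $r$ if there are a Riemannian metric $g$ on $N$, an affine connection $\nabla$ on $N$ that is self-dual with respect to $g$, and a solution $\theta$ of the gauge equation of $(\nabla,\nabla)$ with $g(\theta X,Y)=-g(X,\theta Y)$ for all $X,Y$ and $\operatorname{rank}\theta_x=r$ at every point $x\in N$. An almost contact metric structure on $M$ is a quadruple $(\phi,\xi,\eta,g)$ of a $(1,1)$-tensor, a vector field, a 1-form and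 a Riemannian metric with $\eta(\xi)=1$, $\phi^2=-\mathrm{Id}+\eta\otimes\xi$ and $g(\phi X,\phi Y)=g(X,Y)-\eta(X)\eta(Y)$. An almost Hermitian structure on $W$ is a pair $(J,h)$ of a $(1,1)$-tensor and a Riemannian metric with $J^2=-\mathrm{Id}$ and $h(JX,JY)=h(X,Y)$. Then the following are equivalent: 1. the gauge equation of self-dual connections on $M$ admits a skew-symmetric solution of rank $2n$; 2. $M$ admits an almost contact metric structure; 3. $W$ admits an almost Hermitian structure; 4. the gauge equation of self-dual connections on $W$ admits a skew-symmetric solution of rank $2n+2$. -/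

import Mathlib

open scoped Manifold ContDiff

noncomputable section

namespace GaugeGeometry

section General

variable {E : Type*} [NormedAddCommGroup E] [NormedSpace ℝ E]
  {H : Type*} [TopologicalSpace H] (I : ModelWithCorners ℝ E H)
  {M : Type*} [TopologicalSpace M] [ChartedSpace H M] [IsManifold I ∞ M]

/-- The vector field `X` on `M` is smooth. -/
def SmoothVectorField (X : ∀ x : M, TangentSpace I x) : Prop :=
  ContMDiff I (I.prod 𝓘(ℝ, E)) ∞ (fun x ↦ Bundle.TotalSpace.mk' E x (X x))

/-- The 1-form `η` on `M` is smooth. -/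
def SmoothOneForm (η : ∀ x : M, TangentSpace I x →L[ℝ] ℝ) : Prop :=
  ContMDiff I (I.prod 𝓘(ℝ, E →L[ℝ] ℝ)) ∞
    (fun x ↦ Bundle.TotalSpace.mk' (E →L[ℝ] ℝ) x (η x))

/-- The (1,1)-tensor field `θ` on `M`, viewed as a field of endomorphisms of the tangent
spaces, is smooth. -/
def SmoothEndomorphismField (θ : ∀ x : M, TangentSpace I x →L[ℝ] TangentSpace I x) : Prop :=
  ContMDiff I (I.prod 𝓘(ℝ, E →L[ℝ] E)) ∞
    (fun x ↦ Bundle.TotalSpace.mk' (E →L[ℝ] E) x (θ x))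

variable (M) in
/-- Smooth Riemannian metrics on `M`. -/
abbrev Metric : Type _ :=
  Bundle.ContMDiffRiemannianMetric I ∞ E (fun x : M ↦ TangentSpace I x)

variable (M) in
/-- Affine connections on `M`; in Mathlib's convention `∇_v Y` at `x` is written `∇ Y x v`. -/
abbrev Connection : Type _ :=
  CovariantDerivative I E (fun x : M ↦ TangentSpace I x)

variable {I}

/-- `∇'` is the dual connection of `∇` with respect to `g`:
`Z g(X, Y) = g(∇_Z X, Y) + g(X, ∇'_Z Y)`. -/
def IsDualConnection (g : Metric I M) (nabla nabla' : Connection I M) : Prop :=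
  ∀ X Y : (∀ x : M, TangentSpace I x), SmoothVectorField I X → SmoothVectorField I Y →
    ∀ (x : M) (v : TangentSpace I x),
      mvfderiv I (fun p ↦ g.inner p (X p) (Y p)) x v =
        g.inner x (nabla X x v) (Y x) + g.inner x (X x) (nabla' Y x v)

/-- The connection `∇` is self-dual with respect to `g`: it is its own dual connection. -/
def IsSelfDual (g : Metric I M) (nabla : Connection I M) : Prop :=
  IsDualConnection g nabla nabla

/-- `θ` solves the gauge equation of the pair `(∇, ∇')`: `∇'_X (θ Y) = θ (∇_X Y)`. -/
def SatisfiesGaugeEquation (nabla nabla' : Connection I M)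
    (θ : ∀ x : M, TangentSpace I x →L[ℝ] TangentSpace I x) : Prop :=
  ∀ Y : (∀ x : M, TangentSpace I x), SmoothVectorField I Y →
    ∀ (x : M) (v : TangentSpace I x),
      nabla' (fun p ↦ θ p (Y p)) x v = θ x (nabla Y x v)

/-- `θ` is skew-symmetric with respect to `g`. -/
def IsSkewSymmetric (g : Metric I M)
    (θ : ∀ x : M, TangentSpace I x →L[ℝ] TangentSpace I x) : Prop :=
  ∀ (x : M) (v w : TangentSpace I x), g.inner x (θ x v) w = -g.inner x v (θ x w)

/-- `θ` has rank `r` at every point. -/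
def HasConstantRank (θ : ∀ x : M, TangentSpace I x →L[ℝ] TangentSpace I x) (r : ℕ) : Prop :=
  ∀ x : M, Module.finrank ℝ (LinearMap.range (θ x).toLinearMap) = r

variable (I M)

/-- For some Riemannian metric on `M`, the gauge equation of some smooth self-dual connection has a
smooth skew-symmetric solution of rank `r`. -/
def AdmitsSkewSelfDualGaugeSolution (r : ℕ) : Prop :=
  ∃ (g : Metric I M) (nabla : Connection I M)
    (θ : ∀ x : M, TangentSpace I x →L[ℝ] TangentSpace I x),
    nabla.ContMDiffCovariantDerivative ∞ ∧ IsSelfDual g nabla ∧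
      SmoothEndomorphismField I θ ∧ SatisfiesGaugeEquation nabla nabla θ ∧
      IsSkewSymmetric g θ ∧ HasConstantRank θ r

/-- Almost contact metric structures `(φ, ξ, η, g)`: `η(ξ) = 1`, `φ² = -Id + η ⊗ ξ` and
`g(φ X, φ Y) = g(X, Y) - η(X) η(Y)`. -/
structure AlmostContactMetricStructure where
  φ : ∀ x : M, TangentSpace I x →L[ℝ] TangentSpace I x
  ξ : ∀ x : M, TangentSpace I x
  η : ∀ x : M, TangentSpace I x →L[ℝ] ℝ
  g : Metric I M
  smooth_φ : SmoothEndomorphismField I φ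
  smooth_ξ : SmoothVectorField I ξ
  smooth_η : SmoothOneForm I η
  η_ξ : ∀ x, η x (ξ x) = 1
  φ_φ : ∀ (x : M) (v : TangentSpace I x), φ x (φ x v) = -v + η x v • ξ x
  adapted : ∀ (x : M) (v w : TangentSpace I x),
    g.inner x (φ x v) (φ x w) = g.inner x v w - η x v * η x w

/-- Almost Hermitian structures `(J, h)`: `J² = -Id` and `h(J X, J Y) = h(X, Y)`. -/
structure AlmostHermitianStructure where
  J : ∀ x : M, TangentSpace I x →L[ℝ] TangentSpace I x
  h : Metric I M
  smooth_J : SmoothEndomorphismField I J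
  J_J : ∀ (x : M) (v : TangentSpace I x), J x (J x v) = -v
  hermitian : ∀ (x : M) (v w : TangentSpace I x),
    h.inner x (J x v) (J x w) = h.inner x v w

end General

/-- The `d`-dimensional smooth manifold `M` is orientable: it is covered by smooth charts whose
transition maps all have positive Jacobian determinant. -/
def IsOrientable (d : ℕ) (M : Type*) [TopologicalSpace M]
    [ChartedSpace (EuclideanSpace ℝ (Fin d)) M] : Prop :=
  ∃ A : Set (OpenPartialHomeomorph M (EuclideanSpace ℝ (Fin d))),
    A ⊆ IsManifold.maximalAtlas (𝓡 d) ∞ M ∧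
    (∀ x : M, ∃ e ∈ A, x ∈ e.source) ∧
    ∀ e ∈ A, ∀ e' ∈ A, ∀ x ∈ e.source ∩ e'.source,
      0 < (fderiv ℝ (e' ∘ e.symm) (e x)).det

end GaugeGeometry

end

open scoped Manifold ContDiff

noncomputable section

namespace GaugeGeometry

set_option linter.unusedSectionVars false

open Module Topology

/-! ### Positive operators on a Euclidean space and their square roots -/

section PositiveOperators

/-! A self-dual connection is a metric connection, and a solution of its gauge equation is a
parallel endomorphism field. Torsion is free, so parallelism costs nothing: if `φ` is smooth and
skew with `φ³ = -φ`, any metric connection `D` becomes a metric connection with `φ` parallel after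
averaging `D` with `-φDφ` on the image of `φ` and compressing it to the kernel
(`exists_parallelizing_connection`). This gives 2 → 1 and 3 → 4, the metric connection coming from a
Parseval frame.

Conversely, only the metric and the skew field `θ` of the prescribed rank are used. With `P` the
orthogonal projection to `ker θ`, the operator `P - θ²` is positive, its square root commutes with
`θ`, and `(P - θ²)^(-1/2) θ` is skew with square `-1 + P` (`exists_smooth_polar`). Smoothness of the
root comes from the inverse function theorem. For trivial kernel this is an almost Hermitian
structure, hence 4 → 3.

For one-dimensional kernel it remains to choose a smooth unit kernel field `ξ`. Locally it exists up
to sign. The sign is fixed by orientation: `φ`, `ξ`, `η` define the complex structure `(v, a) ↦ (φ v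
- a ξ, η v)` on `T_x M × ℝ`, and replacing `ξ`, `η` by their negatives conjugates it by a
reflection, which reverses the orientation it induces. Exactly one sign is therefore compatible with
the orientation of `M`, and that choice is locally consistent (`exists_sign_selection`). This gives
1 → 2.

The same complex structure with the product metric gives 2 → 3. For 3 → 2, the tangential part of
`J` along `M × {0}` is skew, and its kernel is the line spanned by `J` of the normal, so the
argument for 1 → 2 applies to it. -/

theorem exists_linearEquiv_euclideanSpace {E : Type*} [AddCommGroup E] [Module ℝ E]
    [FiniteDimensional ℝ E] (B : E → E → ℝ)
    (add : ∀ u v w, B (u + v) w = B u w + B v w) (smul : ∀ (r : ℝ) u v, B (r • u) v = r * B u v)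
    (symm : ∀ u v, B u v = B v u) (pos : ∀ u, u ≠ 0 → 0 < B u u) :
    ∃ L : E ≃ₗ[ℝ] EuclideanSpace ℝ (Fin (finrank ℝ E)), ∀ u v, B u v = inner ℝ (L u) (L v) := by
  have h0 : B 0 0 = 0 := by simpa using smul 0 0 0
  let core : InnerProductSpace.Core ℝ E :=
    { inner := fun u v ↦ B u v
      conj_inner_symm := fun u v ↦ by simpa using symm v u
      re_inner_nonneg := fun u ↦ by
        rcases eq_or_ne u 0 with rfl | h
        · simp [h0]
        · simpa using (pos u h).le
      add_left := fun u v w ↦ add u v w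
      smul_left := fun u v r ↦ by simpa using smul r u v
      definite := fun u hu ↦ by
        by_contra h
        exact (pos u h).ne' hu }
  let _ := core.toNormedAddCommGroup
  let _ : InnerProductSpace ℝ E := InnerProductSpace.ofCore core.toCore
  refine ⟨(stdOrthonormalBasis ℝ E).repr.toLinearEquiv, fun u v ↦ ?_⟩
  exact ((stdOrthonormalBasis ℝ E).repr.inner_map_map u v).symm

variable {F : Type*} [NormedAddCommGroup F] [InnerProductSpace ℝ F] [FiniteDimensional ℝ F]

/-- On an eigenvector `b` of `R` with eigenvalue `l > 0` the equation reads `S (X b) = -l X b`;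
pairing with `X b` contradicts positivity of `S` unless `X b = 0`. This one fact yields
invertibility of the derivative of squaring, uniqueness of positive roots, and their commutation
properties. -/
theorem eq_zero_of_comp_add_comp_eq_zero {S R X : F →ₗ[ℝ] F}
    (hS : ∀ v, v ≠ 0 → 0 < inner ℝ (S v) v) (hR : R.IsSymmetric)
    (hR' : ∀ v, v ≠ 0 → 0 < inner ℝ (R v) v) (h : ∀ v, S (X v) + X (R v) = 0) : X = 0 := by
  refine (hR.eigenvectorBasis rfl).toBasis.ext fun i ↦ ?_
  set b := hR.eigenvectorBasis rfl
  set l := hR.eigenvalues rfl i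
  have hb : R (b i) = l • b i := hR.apply_eigenvectorBasis rfl i
  have hl : 0 < l := by
    have := hR' (b i) (b.orthonormal.ne_zero i)
    rw [hb, inner_smul_left, real_inner_self_eq_norm_sq, b.orthonormal.1 i] at this
    simpa using this
  by_contra hx
  simp only [OrthonormalBasis.coe_toBasis, LinearMap.zero_apply] at hx
  have h1 := h (b i)
  rw [hb, map_smul] at h1
  have h2 := congrArg (fun w ↦ inner ℝ w (X (b i))) h1
  simp only [inner_add_left, inner_smul_left, inner_zero_left, RCLike.conj_to_real] at h2
  have h3 := hS _ hx
  have h4 : 0 < inner ℝ (X (b i)) (X (b i)) := real_inner_self_pos.2 hx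
  nlinarith

theorem exists_isSymmetric_pos_sq_eq {A : F →ₗ[ℝ] F} (hA : A.IsSymmetric)
    (hA' : ∀ v, v ≠ 0 → 0 < inner ℝ (A v) v) :
    ∃ S : F →ₗ[ℝ] F, S.IsSymmetric ∧ (∀ v, v ≠ 0 → 0 < inner ℝ (S v) v) ∧
      ∀ v, S (S v) = A v := by
  set b := hA.eigenvectorBasis rfl with hb
  set l := hA.eigenvalues rfl with hl
  have hAb : ∀ i, A (b i) = l i • b i := fun i ↦ hA.apply_eigenvectorBasis rfl i
  have hpos : ∀ i, 0 < l i := fun i ↦ by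
    have := hA' (b i) (b.orthonormal.ne_zero i)
    rw [hAb, inner_smul_left, real_inner_self_eq_norm_sq, b.orthonormal.1 i] at this
    simpa using this
  let S : F →ₗ[ℝ] F := b.toBasis.constr ℝ fun i ↦ Real.sqrt (l i) • b i
  have hSb : ∀ i, S (b i) = Real.sqrt (l i) • b i := fun i ↦ by
    have := b.toBasis.constr_basis ℝ (fun i ↦ Real.sqrt (l i) • b i) i
    rwa [b.coe_toBasis] at this
  have hS : ∀ v w, inner ℝ (S v) w = ∑ i, Real.sqrt (l i) * (inner ℝ (b i) v * inner ℝ (b i) w) := by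
    intro v w
    conv_lhs => rw [← b.sum_repr' v, map_sum, sum_inner]
    refine Finset.sum_congr rfl fun i _ ↦ ?_
    rw [map_smul, hSb, inner_smul_left, inner_smul_left]
    simp only [RCLike.conj_to_real]
    ring
  refine ⟨S, fun v w ↦ ?_, fun v hv ↦ ?_, fun v ↦ ?_⟩
  · rw [hS, real_inner_comm, hS]
    exact Finset.sum_congr rfl fun i _ ↦ by ring
  · rw [hS]
    have : ∃ i, inner ℝ (b i) v ≠ 0 := by
      by_contra! h
      apply hv
      rw [← b.sum_repr' v]
      simp [h]
    obtain ⟨i, hi⟩ := this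
    refine Finset.sum_pos' (fun j _ ↦ mul_nonneg (Real.sqrt_nonneg _) (mul_self_nonneg _))
      ⟨i, Finset.mem_univ i, mul_pos (Real.sqrt_pos.2 (hpos i)) (mul_self_pos.2 hi)⟩
  · have : S ∘ₗ S = A := b.toBasis.ext fun i ↦ by
      simp only [OrthonormalBasis.coe_toBasis, LinearMap.comp_apply, hSb, map_smul, hAb, smul_smul]
      rw [Real.mul_self_sqrt (hpos i).le]
    exact LinearMap.congr_fun this v

/-- Positive definiteness is an open condition on operators. -/
theorem eventually_inner_pos {A₀ : F →L[ℝ] F} (h : ∀ v, v ≠ 0 → 0 < inner ℝ (A₀ v) v) :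
    ∀ᶠ A : F →L[ℝ] F in 𝓝 A₀, ∀ v, v ≠ 0 → 0 < inner ℝ (A v) v := by
  have hK : IsCompact (Metric.sphere (0 : F) 1) := isCompact_sphere 0 1
  have key : ∀ᶠ A : F →L[ℝ] F in 𝓝 A₀, ∀ v ∈ Metric.sphere (0 : F) 1, 0 < inner ℝ (A v) v := by
    refine hK.eventually_forall_of_forall_eventually fun v hv ↦ ?_
    have hc : Continuous fun p : (F →L[ℝ] F) × F ↦ inner ℝ (p.1 p.2) p.2 := by fun_prop
    have hv' : v ≠ 0 := by rintro rfl; simp at hv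
    exact hc.continuousAt.eventually (lt_mem_nhds (h v hv'))
  filter_upwards [key] with A hA v hv
  have h1 := hA (‖v‖⁻¹ • v) (by simp [norm_smul, hv])
  rw [map_smul, inner_smul_left, inner_smul_right] at h1
  have h2 : 0 < ‖v‖ := norm_pos_iff.2 hv
  by_contra! h3
  simp only [RCLike.conj_to_real] at h1
  have : ‖v‖⁻¹ * (‖v‖⁻¹ * inner ℝ (A v) v) ≤ 0 :=
    mul_nonpos_of_nonneg_of_nonpos (by positivity) (mul_nonpos_of_nonneg_of_nonpos (by positivity) h3)
  linarith

/-- Near a positive operator the positive square root is a smooth function. -/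
theorem exists_contDiffAt_sqrt {S₀ : F →L[ℝ] F} (hS : (S₀ : F →ₗ[ℝ] F).IsSymmetric)
    (hS' : ∀ v, v ≠ 0 → 0 < inner ℝ (S₀ v) v) :
    ∃ r : (F →L[ℝ] F) → (F →L[ℝ] F), ContDiffAt ℝ ∞ r (S₀ * S₀) ∧ r (S₀ * S₀) = S₀ ∧
      ∀ᶠ A : F →L[ℝ] F in 𝓝 (S₀ * S₀), (A : F →ₗ[ℝ] F).IsSymmetric →
        (r A : F →ₗ[ℝ] F).IsSymmetric ∧ (∀ v, v ≠ 0 → 0 < inner ℝ (r A v) v) ∧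
          r A * r A = A := by
  -- `D` is the derivative of squaring at `S₀`. It is injective, hence invertible, so the inverse
  -- function theorem gives the smooth root.
  let D : (F →L[ℝ] F) →ₗ[ℝ] (F →L[ℝ] F) :=
    LinearMap.mulLeft ℝ S₀ + LinearMap.mulRight ℝ S₀
  have hD : Function.Injective D := by
    rw [← LinearMap.ker_eq_bot, LinearMap.ker_eq_bot']
    intro X hX
    have : (X : F →ₗ[ℝ] F) = 0 := eq_zero_of_comp_add_comp_eq_zero (S := S₀) (R := S₀) hS' hS hS'
      fun v ↦ by simpa [D] using congrArg (fun T : F →L[ℝ] F ↦ T v) hX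
    ext v
    exact LinearMap.congr_fun this v
  let e : (F →L[ℝ] F) ≃L[ℝ] (F →L[ℝ] F) :=
    (LinearEquiv.ofInjectiveEndo D hD).toContinuousLinearEquiv
  have hf : ContDiffAt ℝ ∞ (fun T : F →L[ℝ] F ↦ T * T) S₀ := by fun_prop
  have hf' : HasFDerivAt (fun T : F →L[ℝ] F ↦ T * T) (e : (F →L[ℝ] F) →L[ℝ] (F →L[ℝ] F)) S₀ := by
    have := (hasFDerivAt_id (𝕜 := ℝ) S₀).mul' (hasFDerivAt_id (𝕜 := ℝ) S₀)
    refine this.congr_fderiv ?_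
    ext X v
    simp [e, D]
  have hn : (∞ : WithTop ℕ∞) ≠ 0 := by simp
  set p := hf.toOpenPartialHomeomorph _ hf' hn with hp
  have hpc : ∀ T, p T = T * T := fun T ↦ by rw [hp, ContDiffAt.toOpenPartialHomeomorph_coe]
  have h0 : S₀ ∈ p.source := hf.mem_toOpenPartialHomeomorph_source hf' hn
  have h0' : S₀ * S₀ ∈ p.target := by rw [← hpc]; exact p.map_source h0
  have hr0 : p.symm (S₀ * S₀) = S₀ := by rw [← hpc]; exact p.left_inv h0
  have hcr : ContinuousAt p.symm (S₀ * S₀) := p.continuousAt_symm h0'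
  refine ⟨p.symm, hf.to_localInverse hf' hn, hr0, ?_⟩
  have hadj : ∀ T : F →L[ℝ] F, (T : F →ₗ[ℝ] F).IsSymmetric ↔ star T = T := fun T ↦ by
    rw [← ContinuousLinearMap.isSelfAdjoint_iff_isSymmetric]; rfl
  have e1 : ∀ᶠ A in 𝓝 (S₀ * S₀), A ∈ p.target := p.open_target.mem_nhds h0'
  have e2 : ∀ᶠ A in 𝓝 (S₀ * S₀), star (p.symm A) ∈ p.source := by
    have : ContinuousAt (fun A ↦ star (p.symm A)) (S₀ * S₀) := hcr.star
    refine this.eventually (p.open_source.mem_nhds ?_)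
    simpa only [hr0, (hadj _).1 hS] using h0
  have e3 : ∀ᶠ A in 𝓝 (S₀ * S₀), ∀ v, v ≠ 0 → 0 < inner ℝ (p.symm A v) v := by
    refine hcr.eventually (p := fun T : F →L[ℝ] F ↦ ∀ v, v ≠ 0 → 0 < inner ℝ (T v) v) ?_
    rw [hr0]
    exact eventually_inner_pos hS'
  filter_upwards [e1, e2, e3] with A h1 h2 h3 hA
  have hsq : p.symm A * p.symm A = A := by rw [← hpc]; exact p.right_inv h1
  -- The adjoint of the root also squares to `A` and stays in the domain where squaring is
  -- injective, so it equals the root.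
  refine ⟨(hadj _).2 (p.injOn h2 (p.map_target h1) ?_), h3, hsq⟩
  rw [hpc, hpc, ← star_mul, hsq, (hadj _).1 hA]

end PositiveOperators

/-! ### Inner products and positive operators on a vector space without preferred norm -/

section Forms

variable {V : Type*} [AddCommGroup V] [Module ℝ V] [TopologicalSpace V] [IsTopologicalAddGroup V]
  [ContinuousSMul ℝ V]

/-- The bilinear form `B` is an inner product. -/
structure IsInnerProduct (B : V →L[ℝ] V →L[ℝ] ℝ) : Prop where
  symm : ∀ u v, B u v = B v u
  pos : ∀ v, v ≠ 0 → 0 < B v v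

/-- The operator `S` is symmetric and positive definite for the bilinear form `B`. -/
structure IsPositiveOperator (B : V →L[ℝ] V →L[ℝ] ℝ) (S : V →L[ℝ] V) : Prop where
  symm : ∀ u v, B (S u) v = B u (S v)
  pos : ∀ v, v ≠ 0 → 0 < B (S v) v

variable {B : V →L[ℝ] V →L[ℝ] ℝ}

theorem IsInnerProduct.eq_zero (hB : IsInnerProduct B) {v : V} (h : B v v = 0) : v = 0 := by
  by_contra hv
  exact (hB.pos v hv).ne' h

variable [FiniteDimensional ℝ V] [T2Space V]

theorem IsInnerProduct.exists_equiv (hB : IsInnerProduct B) :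
    ∃ L : V ≃L[ℝ] EuclideanSpace ℝ (Fin (finrank ℝ V)), ∀ u v, B u v = inner ℝ (L u) (L v) := by
  obtain ⟨L, hL⟩ := exists_linearEquiv_euclideanSpace (fun u v ↦ B u v) (by simp) (by simp)
    hB.symm hB.pos
  exact ⟨L.toContinuousLinearEquiv, hL⟩

theorem IsPositiveOperator.conj {F : Type*} [NormedAddCommGroup F] [InnerProductSpace ℝ F]
    {S : V →L[ℝ] V} (h : IsPositiveOperator B S)
    (L : V ≃L[ℝ] F) (hL : ∀ u v, B u v = inner ℝ (L u) (L v)) :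
    ((L ∘L S ∘L L.symm : F →L[ℝ] F) : F →ₗ[ℝ] F).IsSymmetric ∧
      ∀ v, v ≠ 0 → 0 < inner ℝ ((L ∘L S ∘L L.symm : F →L[ℝ] F) v) v := by
  refine ⟨fun u v ↦ ?_, fun v hv ↦ ?_⟩
  · have := h.symm (L.symm u) (L.symm v)
    simpa [hL] using this
  · have := h.pos (L.symm v) (by simpa using hv)
    simpa [hL] using this

theorem IsPositiveOperator.of_conj {F : Type*} [NormedAddCommGroup F] [InnerProductSpace ℝ F]
    {S : F →L[ℝ] F} (h : (S : F →ₗ[ℝ] F).IsSymmetric) (h' : ∀ v, v ≠ 0 → 0 < inner ℝ (S v) v)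
    (L : V ≃L[ℝ] F) (hL : ∀ u v, B u v = inner ℝ (L u) (L v)) :
    IsPositiveOperator B (L.symm ∘L S ∘L L : V →L[ℝ] V) := by
  refine ⟨fun u v ↦ ?_, fun v hv ↦ ?_⟩
  · simpa [hL] using h (L u) (L v)
  · simpa [hL] using h' (L v) (by simpa using hv)

theorem IsPositiveOperator.eq_zero_of_comp_add_comp (hB : IsInnerProduct B) {S R X : V →L[ℝ] V}
    (hS : IsPositiveOperator B S) (hR : IsPositiveOperator B R)
    (h : ∀ v, S (X v) + X (R v) = 0) : X = 0 := by
  obtain ⟨L, hL⟩ := hB.exists_equiv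
  have := eq_zero_of_comp_add_comp_eq_zero
    (X := (L.toContinuousLinearMap ∘L X ∘L L.symm.toContinuousLinearMap).toLinearMap)
    (hS.conj L hL).2 (hR.conj L hL).1 (hR.conj L hL).2 fun v ↦ by
      simpa using congrArg L (h (L.symm v))
  ext v
  have h2 := LinearMap.congr_fun this (L v)
  simpa using h2

theorem IsPositiveOperator.exists_sqrt (hB : IsInnerProduct B) {A : V →L[ℝ] V}
    (hA : IsPositiveOperator B A) : ∃ S, IsPositiveOperator B S ∧ ∀ v, S (S v) = A v := by
  obtain ⟨L, hL⟩ := hB.exists_equiv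
  obtain ⟨S, h1, h2, h3⟩ := exists_isSymmetric_pos_sq_eq (hA.conj L hL).1 (hA.conj L hL).2
  refine ⟨_, IsPositiveOperator.of_conj (S := LinearMap.toContinuousLinearMap S) h1 h2 L hL,
    fun v ↦ ?_⟩
  simp [h3]

theorem IsPositiveOperator.eq_of_sq_eq (hB : IsInnerProduct B) {S R : V →L[ℝ] V}
    (hS : IsPositiveOperator B S) (hR : IsPositiveOperator B R)
    (h : ∀ v, S (S v) = R (R v)) : S = R :=
  -- `S(S - R) + (S - R)R = S² - R²`.
  sub_eq_zero.1 <| IsPositiveOperator.eq_zero_of_comp_add_comp hB hS hR fun v ↦ by simp [h]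

theorem IsPositiveOperator.commute_of_commute_sq (hB : IsInnerProduct B) {S X : V →L[ℝ] V}
    (hS : IsPositiveOperator B S) (h : ∀ v, X (S (S v)) = S (S (X v))) (v : V) :
    X (S v) = S (X v) := by
  have : X ∘L S - S ∘L X = 0 :=
    -- `S(XS - SX) + (XS - SX)S = XS² - S²X`.
    IsPositiveOperator.eq_zero_of_comp_add_comp hB hS hS fun v ↦ by simp [h]
  exact sub_eq_zero.1 (congrArg (fun T : V →L[ℝ] V ↦ T v) this)

theorem IsPositiveOperator.injective {S : V →L[ℝ] V} (hS : IsPositiveOperator B S) :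
    Function.Injective S := by
  refine (injective_iff_map_eq_zero S).2 fun v hv ↦ ?_
  by_contra h
  have := hS.pos v h
  simp [hv] at this

end Forms

/-! ### Linear complex structures -/

section ComplexStructures

variable {V : Type*} [AddCommGroup V] [Module ℝ V] [FiniteDimensional ℝ V]

/-- The complex vector space structure defined by a linear complex structure `J`. -/
abbrev complexModule (J : V →ₗ[ℝ] V) (hJ : J * J = -1) : Module ℂ V :=
  Module.compHom V (Complex.liftAux J hJ).toRingHom

theorem complexModule_smul (J : V →ₗ[ℝ] V) (hJ : J * J = -1) (z : ℂ) (v : V) :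
    let _ := complexModule J hJ
    z • v = z.re • v + z.im • J v := by
  change (Complex.liftAux J hJ z) v = _
  rw [Complex.liftAux_apply]
  simp [Algebra.algebraMap_eq_smul_one]

theorem complexModule_isScalarTower (J : V →ₗ[ℝ] V) (hJ : J * J = -1) :
    let _ := complexModule J hJ
    IsScalarTower ℝ ℂ V := by
  intro _
  refine ⟨fun r z v ↦ ?_⟩
  rw [complexModule_smul, complexModule_smul]
  simp [mul_smul, smul_add]

/-- Commuting with `J` makes `T` complex linear, and its real determinant is the squared modulus of
its complex determinant. This is the source of the orientation induced by a complex structure. -/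
theorem det_nonneg_of_commute {J T : V →ₗ[ℝ] V} (hJ : ∀ v, J (J v) = -v)
    (hT : ∀ v, T (J v) = J (T v)) : 0 ≤ LinearMap.det T := by
  have hJ' : J * J = -1 := LinearMap.ext fun v ↦ by simp [hJ]
  let _ := complexModule J hJ'
  have := complexModule_isScalarTower J hJ'
  have := Module.Finite.of_restrictScalars_finite ℝ ℂ V
  let T' : V →ₗ[ℂ] V :=
    { T with map_smul' := fun z v ↦ by simp [complexModule_smul, hT] }
  have h : T'.restrictScalars ℝ = T := rfl
  rw [← h, LinearMap.det_restrictScalars, Algebra.norm_complex_apply]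
  exact Complex.normSq_nonneg _

/-- `J` and `J'` make `V` into complex spaces of the same dimension, so a complex isomorphism
exists. -/
theorem exists_linearEquiv_intertwining {J J' : V →ₗ[ℝ] V} (hJ : ∀ v, J (J v) = -v)
    (hJ' : ∀ v, J' (J' v) = -v) : ∃ T : V ≃ₗ[ℝ] V, ∀ v, T (J v) = J' (T v) := by
  have h1 : J * J = -1 := LinearMap.ext fun v ↦ by simp [hJ]
  have h2 : J' * J' = -1 := LinearMap.ext fun v ↦ by simp [hJ']
  obtain ⟨b⟩ : Nonempty (let _ := complexModule J h1; Basis (Fin (finrank ℝ V / 2)) ℂ V) := by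
    let _ := complexModule J h1
    have := complexModule_isScalarTower J h1
    have := Module.Finite.of_restrictScalars_finite ℝ ℂ V
    have h : finrank ℂ V = finrank ℝ V / 2 := by
      have := finrank_mul_finrank ℝ ℂ V
      rw [Complex.finrank_real_complex] at this
      omega
    exact ⟨finBasisOfFinrankEq ℂ V h⟩
  obtain ⟨b'⟩ : Nonempty (let _ := complexModule J' h2; Basis (Fin (finrank ℝ V / 2)) ℂ V) := by
    let _ := complexModule J' h2
    have := complexModule_isScalarTower J' h2
    have := Module.Finite.of_restrictScalars_finite ℝ ℂ V
    have h : finrank ℂ V = finrank ℝ V / 2 := by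
      have := finrank_mul_finrank ℝ ℂ V
      rw [Complex.finrank_real_complex] at this
      omega
    exact ⟨finBasisOfFinrankEq ℂ V h⟩
  -- The two complex structures on `V` must not be in scope together, so only additive equivalences
  -- are kept, with complex linearity spelled out in terms of `J` and `J'`.
  let e : V ≃+ (Fin (finrank ℝ V / 2) →₀ ℂ) :=
    let _ := complexModule J h1; b.repr.toAddEquiv
  let e' : V ≃+ (Fin (finrank ℝ V / 2) →₀ ℂ) :=
    let _ := complexModule J' h2; b'.repr.toAddEquiv
  have he : ∀ (z : ℂ) v, e (z.re • v + z.im • J v) = z • e v := fun z v ↦ by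
    let _ := complexModule J h1
    rw [← complexModule_smul J h1]
    exact b.repr.map_smul z v
  have he' : ∀ (z : ℂ) v, e' (z.re • v + z.im • J' v) = z • e' v := fun z v ↦ by
    let _ := complexModule J' h2
    rw [← complexModule_smul J' h2]
    exact b'.repr.map_smul z v
  have key : ∀ (z : ℂ) v, e'.symm (e (z.re • v + z.im • J v)) =
      z.re • e'.symm (e v) + z.im • J' (e'.symm (e v)) := fun z v ↦ by
    rw [he, AddEquiv.symm_apply_eq, he', AddEquiv.apply_symm_apply]
  refine ⟨{ (e.trans e'.symm) with map_smul' := fun r v ↦ ?_ }, fun v ↦ ?_⟩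
  · simpa using key r v
  · simpa using key Complex.I v

end ComplexStructures

/-! ### Smooth dependence of isometries, square roots and kernel vectors -/

section SmoothOperators

variable {E : Type*} [NormedAddCommGroup E] [NormedSpace ℝ E] [FiniteDimensional ℝ E]

/-- Near an inner product there is a smooth choice of isometries with the Euclidean space. -/
theorem exists_contDiffAt_isometry {B₀ : E →L[ℝ] E →L[ℝ] ℝ} (h : IsInnerProduct B₀) :
    ∃ Ψ : (E →L[ℝ] E →L[ℝ] ℝ) → (EuclideanSpace ℝ (Fin (finrank ℝ E)) →L[ℝ] E),
      ContDiffAt ℝ ∞ Ψ B₀ ∧ ∀ᶠ B in 𝓝 B₀, IsInnerProduct B →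
        ∃ L : E ≃L[ℝ] EuclideanSpace ℝ (Fin (finrank ℝ E)),
          Ψ B = L.symm ∧ ∀ u v, B u v = inner ℝ (L u) (L v) := by
  obtain ⟨L₀, hL₀⟩ := h.exists_equiv
  set F := EuclideanSpace ℝ (Fin (finrank ℝ E))
  let b := EuclideanSpace.basisFun (Fin (finrank ℝ E)) ℝ
  -- `G B` is the Gram operator of `B` in the coordinates `L₀`, so `√(G B) ∘ L₀` is an isometry for
  -- `B`; `Ψ B` is its inverse.
  let G : (E →L[ℝ] E →L[ℝ] ℝ) → (F →L[ℝ] F) := fun B ↦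
    ∑ i, (ContinuousLinearMap.apply ℝ ℝ (L₀.symm (b i)) ∘L B ∘L
      (L₀.symm : F →L[ℝ] E)).smulRight (b i)
  have hGc : ContDiff ℝ ∞ G := by
    refine ContDiff.sum fun i _ ↦ ContDiff.smulRight ?_ contDiff_const
    exact contDiff_const.clm_comp (contDiff_id.clm_comp contDiff_const)
  have hG : ∀ B u w, inner ℝ (G B u) w = B (L₀.symm u) (L₀.symm w) := by
    intro B u w
    have h1 : G B u = ∑ i, B (L₀.symm u) (L₀.symm (b i)) • b i := by simp [G]
    conv_rhs => rw [← b.sum_repr' w]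
    rw [h1, sum_inner]
    simp only [map_sum, map_smul, smul_eq_mul]
    refine Finset.sum_congr rfl fun i _ ↦ ?_
    rw [inner_smul_left, mul_comm]
    rfl
  have hG0 : G B₀ = (1 : F →L[ℝ] F) * 1 := by
    ext1 u
    refine ext_inner_right ℝ fun w ↦ ?_
    rw [hG, hL₀]
    simp
  obtain ⟨r, hr, hr0, hr1⟩ := exists_contDiffAt_sqrt (S₀ := (1 : F →L[ℝ] F))
    (fun u v ↦ rfl) (fun v hv ↦ real_inner_self_pos.2 hv)
  refine ⟨fun B ↦ (L₀.symm : F →L[ℝ] E) ∘L ContinuousLinearMap.inverse (r (G B)), ?_, ?_⟩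
  · refine contDiffAt_const.clm_comp ?_
    have h1 : ContDiffAt ℝ ∞ (fun B ↦ r (G B)) B₀ :=
      ContDiffAt.comp (g := r) B₀ (by rwa [hG0]) hGc.contDiffAt
    refine ContDiffAt.comp (g := ContinuousLinearMap.inverse) B₀ ?_ h1
    rw [hG0, hr0]
    exact contDiffAt_map_inverse (ContinuousLinearEquiv.refl ℝ F)
  · have h1 : Filter.Tendsto G (𝓝 B₀) (𝓝 (1 * 1)) := by
      rw [← hG0]; exact hGc.continuous.continuousAt
    filter_upwards [h1.eventually hr1] with B hB hBi
    obtain ⟨R1, R2, R3⟩ := hB fun u v ↦ by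
      have := hG B u v
      rw [ContinuousLinearMap.coe_coe, this, real_inner_comm, hG, hBi.symm]
    have hinj : Function.Injective (r (G B)) := by
      refine (injective_iff_map_eq_zero _).2 fun v hv ↦ ?_
      by_contra h
      simpa [hv] using R2 v h
    let R : F ≃L[ℝ] F := (LinearEquiv.ofInjectiveEndo _ hinj).toContinuousLinearEquiv
    have hR : (R : F →L[ℝ] F) = r (G B) := rfl
    refine ⟨L₀.trans R, ?_, fun u v ↦ ?_⟩
    · rw [← hR, ContinuousLinearMap.inverse_equiv]
      rfl
    · have h2 : ∀ u, R u = r (G B) u := fun u ↦ rfl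
      have h3 := R1 (r (G B) (L₀ u)) (L₀ v)
      have h4 := congrArg (fun T : F →L[ℝ] F ↦ T (L₀ u)) R3
      simp only [mul_apply_eq_comp] at h4
      rw [ContinuousLinearMap.coe_coe, h4, hG] at h3
      simpa [h2] using h3

/-- Near a positive operator the positive square root is a smooth function of the operator and of
the inner product. -/
theorem exists_contDiffAt_sqrt_form {B₀ : E →L[ℝ] E →L[ℝ] ℝ} {A₀ : E →L[ℝ] E}
    (h : IsInnerProduct B₀) (hA₀ : IsPositiveOperator B₀ A₀) :
    ∃ Φ : (E →L[ℝ] E →L[ℝ] ℝ) × (E →L[ℝ] E) → (E →L[ℝ] E),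
      ContDiffAt ℝ ∞ Φ (B₀, A₀) ∧ ∀ᶠ p in 𝓝 (B₀, A₀), IsInnerProduct p.1 →
        IsPositiveOperator p.1 p.2 →
          IsPositiveOperator p.1 (Φ p) ∧ ∀ v, Φ p (Φ p v) = p.2 v := by
  obtain ⟨Ψ, hΨ, hΨ1⟩ := exists_contDiffAt_isometry h
  obtain ⟨L₀, hL₀, hL₀'⟩ := hΨ1.self_of_nhds h
  set F := EuclideanSpace ℝ (Fin (finrank ℝ E))
  obtain ⟨s, hs1, hs2, hs3⟩ := exists_isSymmetric_pos_sq_eq (hA₀.conj L₀ hL₀').1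
    (hA₀.conj L₀ hL₀').2
  obtain ⟨r, hr, hr0, hr1⟩ := exists_contDiffAt_sqrt (S₀ := LinearMap.toContinuousLinearMap s)
    hs1 hs2
  -- Conjugation by the isometry moves the operator to a fixed Euclidean space, where the root is
  -- smooth in one variable.
  let C : (E →L[ℝ] E →L[ℝ] ℝ) × (E →L[ℝ] E) → (F →L[ℝ] F) := fun p ↦
    (Ψ p.1).inverse ∘L p.2 ∘L Ψ p.1
  have hΨ' : ContDiffAt ℝ ∞ (fun p : (E →L[ℝ] E →L[ℝ] ℝ) × (E →L[ℝ] E) ↦ Ψ p.1) (B₀, A₀) :=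
    ContDiffAt.comp (g := Ψ) (f := Prod.fst) (B₀, A₀) hΨ contDiffAt_fst
  have hinv : ContDiffAt ℝ ∞ (fun p : (E →L[ℝ] E →L[ℝ] ℝ) × (E →L[ℝ] E) ↦ (Ψ p.1).inverse)
      (B₀, A₀) := by
    refine ContDiffAt.comp (g := ContinuousLinearMap.inverse) (B₀, A₀) ?_ hΨ'
    rw [hL₀]
    exact contDiffAt_map_inverse L₀.symm
  have hC : ContDiffAt ℝ ∞ C (B₀, A₀) := hinv.clm_comp (contDiffAt_snd.clm_comp hΨ')
  have hC0 : C (B₀, A₀) = LinearMap.toContinuousLinearMap s * LinearMap.toContinuousLinearMap s := by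
    ext1 v
    simp only [C, hL₀, ContinuousLinearMap.inverse_equiv]
    have := hs3 v
    simp only [mul_apply_eq_comp, LinearMap.coe_toContinuousLinearMap', this]
    rfl
  refine ⟨fun p ↦ Ψ p.1 ∘L r (C p) ∘L (Ψ p.1).inverse, ?_, ?_⟩
  · refine hΨ'.clm_comp (ContDiffAt.clm_comp ?_ hinv)
    exact ContDiffAt.comp (g := r) (B₀, A₀) (by rwa [hC0]) hC
  · have h1 : Filter.Tendsto C (𝓝 (B₀, A₀)) (𝓝 (C (B₀, A₀))) := hC.continuousAt
    rw [hC0] at h1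
    have h2 : Filter.Tendsto Prod.fst (𝓝 (B₀, A₀)) (𝓝 B₀) := continuousAt_fst
    filter_upwards [h1.eventually hr1, h2.eventually hΨ1] with p hp hp' hB hA
    obtain ⟨L, hL, hL'⟩ := hp' hB
    have hCp : C p = (L : E →L[ℝ] F) ∘L p.2 ∘L (L.symm : F →L[ℝ] E) := by
      simp only [C, hL, ContinuousLinearMap.inverse_equiv]
      rfl
    obtain ⟨R1, R2, R3⟩ := hp (by rw [hCp]; exact (hA.conj L hL').1)
    have hi : (Ψ p.1).inverse = (L : E →L[ℝ] F) := by
      rw [hL, ContinuousLinearMap.inverse_equiv]; rfl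
    rw [hi, hL]
    refine ⟨IsPositiveOperator.of_conj R1 R2 L hL', fun v ↦ ?_⟩
    have h4 := congrArg (fun T : F →L[ℝ] F ↦ T (L v)) R3
    simp only [mul_apply_eq_comp] at h4
    have h5 : L.symm (C p (L v)) = p.2 v := by simp [hCp]
    rw [← h5, ← h4]
    simp

/-- Near a skew-symmetric operator with one-dimensional kernel there is a smooth choice of unit
kernel vectors of skew-symmetric singular operators. -/
theorem exists_contDiffAt_kernel {B₀ : E →L[ℝ] E →L[ℝ] ℝ} {θ₀ : E →L[ℝ] E} {v₀ : E}
    (hskew : ∀ u v, B₀ (θ₀ u) v = -B₀ u (θ₀ v)) (hv₀ : θ₀ v₀ = 0)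
    (hv₀' : B₀ v₀ v₀ = 1) (hker : ∀ k, θ₀ k = 0 → ∃ c : ℝ, k = c • v₀) :
    ∃ ζ : (E →L[ℝ] E →L[ℝ] ℝ) × (E →L[ℝ] E) → E,
      ContDiffAt ℝ ∞ ζ (B₀, θ₀) ∧ ζ (B₀, θ₀) = v₀ ∧ ∀ᶠ p in 𝓝 (B₀, θ₀), IsInnerProduct p.1 →
        (∀ u v, p.1 (p.2 u) v = -p.1 u (p.2 v)) → (∃ k, k ≠ 0 ∧ p.2 k = 0) →
          p.2 (ζ p) = 0 ∧ p.1 (ζ p) (ζ p) = 1 := by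
  -- The rank-one term fills the kernel of `θ₀`, so `C` is invertible near the base point. The
  -- kernel vector will be `w = C⁻¹ v₀`, normalised.
  let C : (E →L[ℝ] E →L[ℝ] ℝ) × (E →L[ℝ] E) → (E →L[ℝ] E) := fun p ↦
    p.2 + (p.1 v₀).smulRight v₀
  have hC : ContDiff ℝ ∞ C :=
    contDiff_snd.add ((contDiff_fst.clm_apply contDiff_const).smulRight contDiff_const)
  have hinj : Function.Injective (C (B₀, θ₀)) := by
    refine (injective_iff_map_eq_zero _).2 fun k hk ↦ ?_
    simp only [C, add_apply, ContinuousLinearMap.smulRight_apply] at hk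
    have h1 := congrArg (fun w ↦ B₀ w v₀) hk
    simp only [map_add, map_smul, add_apply, smul_apply,
      hskew, hv₀, hv₀', map_zero, zero_apply, smul_eq_mul] at h1
    have h2 : B₀ v₀ k = 0 := by linarith
    rw [h2, zero_smul, add_zero] at hk
    obtain ⟨c, rfl⟩ := hker k hk
    rw [map_smul, hv₀', smul_eq_mul, mul_one] at h2
    simp [h2]
  let e : E ≃L[ℝ] E := (LinearEquiv.ofInjectiveEndo _ hinj).toContinuousLinearEquiv
  have he : (e : E →L[ℝ] E) = C (B₀, θ₀) := rfl
  let w : (E →L[ℝ] E →L[ℝ] ℝ) × (E →L[ℝ] E) → E := fun p ↦ (C p).inverse v₀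
  have hw : ContDiffAt ℝ ∞ w (B₀, θ₀) := by
    refine ContDiffAt.clm_apply ?_ contDiffAt_const
    refine ContDiffAt.comp (g := ContinuousLinearMap.inverse) _ ?_ hC.contDiffAt
    rw [← he]
    exact contDiffAt_map_inverse e
  have hw0 : w (B₀, θ₀) = v₀ := by
    simp only [w]
    rw [← he, ContinuousLinearMap.inverse_equiv, ContinuousLinearEquiv.coe_coe,
      ContinuousLinearEquiv.symm_apply_eq]
    change v₀ = C (B₀, θ₀) v₀
    simp [C, hv₀, hv₀']
  have hww : ContDiffAt ℝ ∞
      (fun p : (E →L[ℝ] E →L[ℝ] ℝ) × (E →L[ℝ] E) ↦ p.1 (w p) (w p)) (B₀, θ₀) :=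
    (contDiffAt_fst.clm_apply hw).clm_apply hw
  refine ⟨fun p ↦ (Real.sqrt (p.1 (w p) (w p)))⁻¹ • w p, ?_, ?_, ?_⟩
  · refine ContDiffAt.smul (ContDiffAt.inv (hww.sqrt ?_) ?_) hw <;> simp [hw0, hv₀']
  · simp [hw0, hv₀']
  · have h1 : ∀ᶠ p in 𝓝 (B₀, θ₀), C p ∈ Set.range ((↑) : (E ≃L[ℝ] E) → (E →L[ℝ] E)) :=
      hC.continuous.continuousAt.eventually (ContinuousLinearEquiv.nhds e)
    filter_upwards [h1] with p hp hB hsk hk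
    obtain ⟨f, hf⟩ := hp
    obtain ⟨k, hk0, hk⟩ := hk
    have hCw : C p (w p) = v₀ := by
      simp only [w]
      rw [← hf, ContinuousLinearMap.inverse_equiv]
      simp
    simp only [C, add_apply, ContinuousLinearMap.smulRight_apply] at hCw
    have hvk : p.1 v₀ k ≠ 0 := fun h0 ↦ hk0 <| f.injective <| by
      rw [map_zero]
      change (f : E →L[ℝ] E) k = 0
      rw [hf]
      simp [C, hk, h0]
    -- Pairing `θ w + B(v₀, w) v₀ = v₀` with `k ∈ ker θ` kills `θ w` by skewness. Hence `B(v₀, w) =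
    -- 1`, and the equation becomes `θ w = 0`.
    have h2 := congrArg (fun w ↦ p.1 w k) hCw
    simp only [map_add, map_smul, add_apply, smul_apply,
      hsk, hk, map_zero, smul_eq_mul] at h2
    have h3 : p.1 v₀ (w p) = 1 := mul_right_cancel₀ hvk (by linarith)
    rw [h3, one_smul, add_eq_right] at hCw
    have hw1 : w p ≠ 0 := fun h0 ↦ by simp [h0] at h3
    have h4 := hB.pos _ hw1
    refine ⟨by simp [hCw], ?_⟩
    simp only [map_smul, smul_apply, smul_eq_mul]
    rw [← mul_assoc, ← mul_inv, Real.mul_self_sqrt h4.le, inv_mul_cancel₀ h4.ne']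

end SmoothOperators

/-! ### Smooth tensor fields in local coordinates -/

section Coordinates

variable {E : Type*} [NormedAddCommGroup E] [NormedSpace ℝ E]
  {H : Type*} [TopologicalSpace H] (I : ModelWithCorners ℝ E H)
  {M : Type*} [TopologicalSpace M] [ChartedSpace H M] [IsManifold I ∞ M]

instance : IsManifold I 1 M := .of_le (n := ∞) (by simp)

instance (x : M) : T2Space (TangentSpace I x) := inferInstanceAs (T2Space E)

instance [FiniteDimensional ℝ E] (x : M) : FiniteDimensional ℝ (TangentSpace I x) :=
  inferInstanceAs (FiniteDimensional ℝ E)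

/-- The identification of the tangent space at `x` with the model space by the preferred chart
at `x₀`. -/
def tangentCoord (x₀ x : M) : TangentSpace I x →L[ℝ] E :=
  (trivializationAt E (TangentSpace I) x₀).continuousLinearMapAt ℝ x

variable {I}

theorem eventually_tangentCoord_equiv (x₀ : M) : ∀ᶠ x in 𝓝 x₀,
    ∃ e : TangentSpace I x ≃L[ℝ] E, ∀ v, e v = tangentCoord I x₀ x v := by
  set t := trivializationAt E (TangentSpace I) x₀
  filter_upwards [t.open_baseSet.mem_nhds (FiberBundle.mem_baseSet_trivializationAt' x₀)] with x hx
  refine ⟨t.continuousLinearEquivAt ℝ x hx, fun v ↦ ?_⟩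
  simp [tangentCoord, t, Bundle.Trivialization.continuousLinearMapAt_apply,
    Bundle.Trivialization.coe_linearMapAt_of_mem _ hx]

theorem eventually_tangentCoord_symmL (x₀ : M) : ∀ᶠ x in 𝓝 x₀,
    (∀ v, (trivializationAt E (TangentSpace I) x₀).symmL ℝ x (tangentCoord I x₀ x v) = v) ∧
      ∀ u, tangentCoord I x₀ x ((trivializationAt E (TangentSpace I) x₀).symmL ℝ x u) = u := by
  set t := trivializationAt E (TangentSpace I) x₀
  filter_upwards [t.open_baseSet.mem_nhds (FiberBundle.mem_baseSet_trivializationAt' x₀)] with x hx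
  exact ⟨fun v ↦ t.symmL_continuousLinearMapAt hx v, fun u ↦ t.continuousLinearMapAt_symmL hx u⟩

theorem contMDiffAt_vector_iff {Y : ∀ x : M, TangentSpace I x} {x₀ : M} :
    ContMDiffAt I (I.prod 𝓘(ℝ, E)) ∞ (fun x ↦ Bundle.TotalSpace.mk' E x (Y x)) x₀ ↔
      ContMDiffAt I 𝓘(ℝ, E) ∞ (fun x ↦ tangentCoord I x₀ x (Y x)) x₀ := by
  rw [Bundle.contMDiffAt_section]
  set t := trivializationAt E (TangentSpace I) x₀
  refine Filter.EventuallyEq.contMDiffAt_iff ?_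
  filter_upwards [t.open_baseSet.mem_nhds (FiberBundle.mem_baseSet_trivializationAt' x₀)] with x hx
  simp [tangentCoord, t, Bundle.Trivialization.continuousLinearMapAt_apply,
    Bundle.Trivialization.coe_linearMapAt_of_mem _ hx]

/-- Asking only for some smooth local representative reduces smoothness of tensor operations to
smoothness of maps between fixed normed spaces. -/
theorem contMDiffAt_endomorphism_iff {θ : ∀ x : M, TangentSpace I x →L[ℝ] TangentSpace I x}
    {x₀ : M} :
    ContMDiffAt I (I.prod 𝓘(ℝ, E →L[ℝ] E)) ∞
      (fun x ↦ Bundle.TotalSpace.mk' (E →L[ℝ] E) x (θ x)) x₀ ↔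
      ∃ a : M → E →L[ℝ] E, ContMDiffAt I 𝓘(ℝ, E →L[ℝ] E) ∞ a x₀ ∧
        ∀ᶠ x in 𝓝 x₀, ∀ v, tangentCoord I x₀ x (θ x v) = a x (tangentCoord I x₀ x v) := by
  rw [contMDiffAt_hom_bundle]
  constructor
  · rintro ⟨-, h⟩
    refine ⟨_, h, ?_⟩
    filter_upwards [eventually_tangentCoord_symmL (I := I) x₀] with x hx v
    change _ = tangentCoord I x₀ x (θ x ((trivializationAt E (TangentSpace I) x₀).symmL ℝ x
      (tangentCoord I x₀ x v)))
    rw [hx.1]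
  · rintro ⟨a, ha, h⟩
    refine ⟨contMDiffAt_id, ha.congr_of_eventuallyEq ?_⟩
    filter_upwards [eventually_tangentCoord_symmL (I := I) x₀, h] with x hx h
    ext u
    have := h ((trivializationAt E (TangentSpace I) x₀).symmL ℝ x u)
    rw [hx.2] at this
    rw [← this]
    rfl

theorem contMDiffAt_oneForm_iff {η : ∀ x : M, TangentSpace I x →L[ℝ] ℝ} {x₀ : M} :
    ContMDiffAt I (I.prod 𝓘(ℝ, E →L[ℝ] ℝ)) ∞
      (fun x ↦ Bundle.TotalSpace.mk' (E →L[ℝ] ℝ) x (η x)) x₀ ↔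
      ∃ a : M → E →L[ℝ] ℝ, ContMDiffAt I 𝓘(ℝ, E →L[ℝ] ℝ) ∞ a x₀ ∧
        ∀ᶠ x in 𝓝 x₀, ∀ v, η x v = a x (tangentCoord I x₀ x v) := by
  have key := contMDiffAt_hom_bundle (𝕜 := ℝ) (IB := I) (IM := I) (n := ∞) (F₁ := E) (F₂ := ℝ)
    (E₁ := fun x : M ↦ TangentSpace I x) (E₂ := Bundle.Trivial M ℝ)
    (fun x ↦ Bundle.TotalSpace.mk' (E →L[ℝ] ℝ) x (η x)) (x₀ := x₀)
  refine key.trans ?_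
  constructor
  · rintro ⟨-, h⟩
    refine ⟨_, h, ?_⟩
    filter_upwards [eventually_tangentCoord_symmL (I := I) x₀] with x hx v
    simp [ContinuousLinearMap.inCoordinates, hx]
  · rintro ⟨a, ha, h⟩
    refine ⟨contMDiffAt_id, ha.congr_of_eventuallyEq ?_⟩
    filter_upwards [eventually_tangentCoord_symmL (I := I) x₀, h] with x hx h
    ext u
    have := h ((trivializationAt E (TangentSpace I) x₀).symmL ℝ x u)
    rw [hx.2] at this
    rw [← this]
    simp [ContinuousLinearMap.inCoordinates]

theorem contMDiffAt_bilinear_iff {B : ∀ x : M, TangentSpace I x →L[ℝ] TangentSpace I x →L[ℝ] ℝ}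
    {x₀ : M} :
    ContMDiffAt I (I.prod 𝓘(ℝ, E →L[ℝ] E →L[ℝ] ℝ)) ∞
      (fun x ↦ Bundle.TotalSpace.mk' (E →L[ℝ] E →L[ℝ] ℝ) x (B x)) x₀ ↔
      ∃ a : M → E →L[ℝ] E →L[ℝ] ℝ, ContMDiffAt I 𝓘(ℝ, E →L[ℝ] E →L[ℝ] ℝ) ∞ a x₀ ∧
        ∀ᶠ x in 𝓝 x₀, ∀ v w,
          B x v w = a x (tangentCoord I x₀ x v) (tangentCoord I x₀ x w) := by
  have key := contMDiffAt_hom_bundle (𝕜 := ℝ) (IB := I) (IM := I) (n := ∞) (F₁ := E)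
    (F₂ := E →L[ℝ] ℝ) (E₁ := fun x : M ↦ TangentSpace I x)
    (E₂ := fun x : M ↦ TangentSpace I x →L[ℝ] Bundle.Trivial M ℝ x)
    (fun x ↦ Bundle.TotalSpace.mk' (E →L[ℝ] E →L[ℝ] ℝ) x (B x)) (x₀ := x₀)
  refine key.trans ?_
  set t := trivializationAt E (TangentSpace I) x₀
  have hin : ∀ᶠ x in 𝓝 x₀, ∀ u w, ContinuousLinearMap.inCoordinates E
      (fun x : M ↦ TangentSpace I x) (E →L[ℝ] ℝ)
      (fun x : M ↦ TangentSpace I x →L[ℝ] Bundle.Trivial M ℝ x) x₀ x x₀ x (B x) u w =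
        B x (t.symmL ℝ x u) (t.symmL ℝ x w) := by
    filter_upwards [t.open_baseSet.mem_nhds (FiberBundle.mem_baseSet_trivializationAt' x₀)]
      with x hx u w
    rw [inCoordinates_apply_eq₂ (F₃ := ℝ) (E₃ := Bundle.Trivial M ℝ) hx hx (by simp)]
    simp [t, Bundle.Trivialization.symmL_apply _ hx]
  constructor
  · rintro ⟨-, h⟩
    refine ⟨_, h, ?_⟩
    filter_upwards [eventually_tangentCoord_symmL (I := I) x₀, hin] with x hx hin v w
    rw [hin, hx.1, hx.1]
  · rintro ⟨a, ha, h⟩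
    refine ⟨contMDiffAt_id, ha.congr_of_eventuallyEq ?_⟩
    filter_upwards [eventually_tangentCoord_symmL (I := I) x₀, h, hin] with x hx h hin
    ext u w
    rw [← hx.2 u, ← hx.2 w, ← h, hx.2, hx.2]
    exact hin u w

theorem contMDiff_endomorphism_comp {θ θ' : ∀ x : M, TangentSpace I x →L[ℝ] TangentSpace I x}
    (h : SmoothEndomorphismField I θ) (h' : SmoothEndomorphismField I θ') :
    SmoothEndomorphismField I fun x ↦ θ x ∘L θ' x := by
  intro x₀
  obtain ⟨a, ha, ha'⟩ := contMDiffAt_endomorphism_iff.1 (h x₀)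
  obtain ⟨b, hb, hb'⟩ := contMDiffAt_endomorphism_iff.1 (h' x₀)
  refine contMDiffAt_endomorphism_iff.2 ⟨fun x ↦ a x ∘L b x, ha.clm_comp hb, ?_⟩
  filter_upwards [ha', hb'] with x h1 h2 v
  simp [h1, h2]

theorem contMDiff_endomorphism_apply {θ : ∀ x : M, TangentSpace I x →L[ℝ] TangentSpace I x}
    {Y : ∀ x : M, TangentSpace I x} (h : SmoothEndomorphismField I θ)
    (h' : SmoothVectorField I Y) : SmoothVectorField I fun x ↦ θ x (Y x) :=
  ContMDiff.clm_bundle_apply h h'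

theorem contMDiff_endomorphism_id :
    SmoothEndomorphismField I fun x : M ↦ ContinuousLinearMap.id ℝ (TangentSpace I x) := fun x₀ ↦
  contMDiffAt_endomorphism_iff.2 ⟨fun _ ↦ ContinuousLinearMap.id ℝ E, contMDiffAt_const, by simp⟩

theorem contMDiffAt_oneForm_smulRight {η : ∀ x : M, TangentSpace I x →L[ℝ] ℝ}
    {Y : ∀ x : M, TangentSpace I x} {x₀ : M}
    (h : ContMDiffAt I (I.prod 𝓘(ℝ, E →L[ℝ] ℝ)) ∞
      (fun x ↦ Bundle.TotalSpace.mk' (E →L[ℝ] ℝ) x (η x)) x₀)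
    (h' : ContMDiffAt I (I.prod 𝓘(ℝ, E)) ∞ (fun x ↦ Bundle.TotalSpace.mk' E x (Y x)) x₀) :
    ContMDiffAt I (I.prod 𝓘(ℝ, E →L[ℝ] E)) ∞
      (fun x ↦ Bundle.TotalSpace.mk' (E →L[ℝ] E) x ((η x).smulRight (Y x))) x₀ := by
  obtain ⟨a, ha, ha'⟩ := contMDiffAt_oneForm_iff.1 h
  have hY := contMDiffAt_vector_iff.1 h'
  refine contMDiffAt_endomorphism_iff.2 ⟨fun x ↦ (a x).smulRight (tangentCoord I x₀ x (Y x)),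
    ?_, ?_⟩
  · exact ContDiff.comp_contMDiffAt
      (g := fun p : (E →L[ℝ] ℝ) × E ↦ p.1.smulRight p.2) (f := fun x ↦ (a x, _))
      (contDiff_fst.smulRight contDiff_snd) (ha.prodMk_space hY)
  · filter_upwards [ha'] with x h1 v
    simp [h1]

theorem contMDiff_oneForm_smulRight {η : ∀ x : M, TangentSpace I x →L[ℝ] ℝ}
    {Y : ∀ x : M, TangentSpace I x} (h : SmoothOneForm I η) (h' : SmoothVectorField I Y) :
    SmoothEndomorphismField I fun x ↦ (η x).smulRight (Y x) := fun x₀ ↦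
  contMDiffAt_oneForm_smulRight (h x₀) (h' x₀)

theorem contMDiffAt_metric_flat (g : Metric I M) {Y : ∀ x : M, TangentSpace I x} {x₀ : M}
    (h : ContMDiffAt I (I.prod 𝓘(ℝ, E)) ∞ (fun x ↦ Bundle.TotalSpace.mk' E x (Y x)) x₀) :
    ContMDiffAt I (I.prod 𝓘(ℝ, E →L[ℝ] ℝ)) ∞
      (fun x ↦ Bundle.TotalSpace.mk' (E →L[ℝ] ℝ) x (g.inner x (Y x))) x₀ := by
  obtain ⟨a, ha, ha'⟩ := contMDiffAt_bilinear_iff.1 (g.contMDiff x₀)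
  have hY := contMDiffAt_vector_iff.1 h
  refine contMDiffAt_oneForm_iff.2 ⟨fun x ↦ a x (tangentCoord I x₀ x (Y x)), ha.clm_apply hY, ?_⟩
  filter_upwards [ha'] with x h1 v
  simp [h1]

theorem contMDiff_metric_flat (g : Metric I M) {Y : ∀ x : M, TangentSpace I x}
    (h : SmoothVectorField I Y) : SmoothOneForm I fun x ↦ g.inner x (Y x) := fun x₀ ↦
  contMDiffAt_metric_flat g (h x₀)

theorem contMDiff_metric_apply (g : Metric I M) {X Y : ∀ x : M, TangentSpace I x}
    (hX : SmoothVectorField I X) (hY : SmoothVectorField I Y) :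
    ContMDiff I 𝓘(ℝ, ℝ) ∞ fun x ↦ g.inner x (X x) (Y x) := by
  intro x₀
  obtain ⟨a, ha, ha'⟩ := contMDiffAt_bilinear_iff.1 (g.contMDiff x₀)
  have hX := contMDiffAt_vector_iff.1 (hX x₀)
  have hY := contMDiffAt_vector_iff.1 (hY x₀)
  refine ((ha.clm_apply hX).clm_apply hY).congr_of_eventuallyEq ?_
  filter_upwards [ha'] with x h1
  simp [h1]

theorem isInnerProduct_metric (g : Metric I M) (x : M) : IsInnerProduct (g.inner x) :=
  ⟨g.symm x, g.pos x⟩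

theorem IsInnerProduct.of_equiv {V W : Type*} [AddCommGroup V] [Module ℝ V] [TopologicalSpace V]
    [AddCommGroup W] [Module ℝ W] [TopologicalSpace W]
    [IsTopologicalAddGroup V] [ContinuousSMul ℝ V] [IsTopologicalAddGroup W] [ContinuousSMul ℝ W]
    {B : V →L[ℝ] V →L[ℝ] ℝ} {B' : W →L[ℝ] W →L[ℝ] ℝ} (h : IsInnerProduct B) (e : V ≃L[ℝ] W)
    (he : ∀ u v, B u v = B' (e u) (e v)) : IsInnerProduct B' := by
  refine ⟨fun u v ↦ ?_, fun v hv ↦ ?_⟩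
  · have := h.symm (e.symm u) (e.symm v)
    simpa [he] using this
  · have := h.pos (e.symm v) (by simpa using hv)
    simpa [he] using this

theorem IsPositiveOperator.of_equiv {V W : Type*} [AddCommGroup V] [Module ℝ V]
    [TopologicalSpace V] [AddCommGroup W] [Module ℝ W] [TopologicalSpace W]
    [IsTopologicalAddGroup V] [ContinuousSMul ℝ V] [IsTopologicalAddGroup W] [ContinuousSMul ℝ W]
    {B : V →L[ℝ] V →L[ℝ] ℝ} {B' : W →L[ℝ] W →L[ℝ] ℝ} {S : V →L[ℝ] V} {S' : W →L[ℝ] W}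
    (h : IsPositiveOperator B S) (e : V ≃L[ℝ] W)
    (he : ∀ u v, B u v = B' (e u) (e v)) (hS : ∀ v, e (S v) = S' (e v)) :
    IsPositiveOperator B' S' := by
  refine ⟨fun u v ↦ ?_, fun v hv ↦ ?_⟩
  · have := h.symm (e.symm u) (e.symm v)
    simpa [he, hS] using this
  · have := h.pos (e.symm v) (by simpa using hv)
    simpa [he, hS] using this

variable [FiniteDimensional ℝ E]

/-- The Riemannian metric given by a smooth field of inner products. -/
def metricOfInnerProduct (B : ∀ x : M, TangentSpace I x →L[ℝ] TangentSpace I x →L[ℝ] ℝ)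
    (h : ∀ x, IsInnerProduct (B x))
    (h' : ContMDiff I (I.prod 𝓘(ℝ, E →L[ℝ] E →L[ℝ] ℝ)) ∞
      (fun x ↦ Bundle.TotalSpace.mk' (E →L[ℝ] E →L[ℝ] ℝ) x (B x))) : Metric I M where
  inner := B
  symm x := (h x).symm
  pos x := (h x).pos
  isVonNBounded x := by
    -- The unit ball of the form is the image of a Euclidean ball under a continuous linear map.
    obtain ⟨L, hL⟩ := (h x).exists_equiv
    have h1 : Bornology.IsVonNBounded ℝ
        (Metric.ball (0 : EuclideanSpace ℝ (Fin (finrank ℝ (TangentSpace I x)))) 1) :=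
      NormedSpace.isVonNBounded_ball ℝ _ 1
    refine (h1.image (L.symm : _ →L[ℝ] TangentSpace I x)).subset ?_
    intro v hv
    refine ⟨L v, ?_, by simp⟩
    have hv : B x v v < 1 := hv
    rw [hL, real_inner_self_eq_norm_sq] at hv
    rw [mem_ball_zero_iff]
    nlinarith [norm_nonneg (L v)]
  contMDiff := h'

theorem contMDiff_endomorphism_inverse
    {θ θ' : ∀ x : M, TangentSpace I x →L[ℝ] TangentSpace I x}
    (h : SmoothEndomorphismField I θ) (h1 : ∀ x v, θ x (θ' x v) = v)
    (h2 : ∀ x v, θ' x (θ x v) = v) : SmoothEndomorphismField I θ' := by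
  intro x₀
  obtain ⟨a, ha, ha'⟩ := contMDiffAt_endomorphism_iff.1 (h x₀)
  have key : ∀ᶠ x in 𝓝 x₀, ∃ f : E ≃L[ℝ] E, (f : E →L[ℝ] E) = a x ∧
      ∀ v, tangentCoord I x₀ x (θ' x v) = f.symm (tangentCoord I x₀ x v) := by
    filter_upwards [ha', eventually_tangentCoord_equiv (I := I) x₀] with x hx ⟨e, he⟩
    let f := (e.symm.trans (ContinuousLinearEquiv.equivOfInverse (θ x) (θ' x) (h2 x) (h1 x))).trans e
    have hf : ∀ v, f v = e (θ x (e.symm v)) := fun v ↦ rfl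
    have hf' : ∀ v, f.symm v = e (θ' x (e.symm v)) := fun v ↦ rfl
    refine ⟨f, ?_, fun v ↦ ?_⟩
    · ext v
      rw [ContinuousLinearEquiv.coe_coe, hf, he, hx, ← he, e.apply_symm_apply]
    · rw [hf', ← he, ← he, e.symm_apply_apply]
  refine contMDiffAt_endomorphism_iff.2 ⟨fun x ↦ (a x).inverse, ?_, ?_⟩
  · obtain ⟨f, hf, -⟩ := key.self_of_nhds
    refine ContDiffAt.comp_contMDiffAt (g := ContinuousLinearMap.inverse) ?_ ha
    rw [← hf]
    exact contDiffAt_map_inverse f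
  · filter_upwards [key] with x ⟨f, hf, hf'⟩ v
    rw [hf', ← hf, ContinuousLinearMap.inverse_equiv]
    rfl

/-- The root is chosen pointwise. By uniqueness it agrees in coordinates with the locally smooth
root, so no gluing is needed. -/
theorem exists_smooth_sqrt (g : Metric I M)
    {A : ∀ x : M, TangentSpace I x →L[ℝ] TangentSpace I x} (hA : SmoothEndomorphismField I A)
    (hA' : ∀ x, IsPositiveOperator (g.inner x) (A x)) :
    ∃ S : ∀ x : M, TangentSpace I x →L[ℝ] TangentSpace I x, SmoothEndomorphismField I S ∧
      (∀ x, IsPositiveOperator (g.inner x) (S x)) ∧ ∀ x v, S x (S x v) = A x v := by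
  choose S hS hSA using fun x ↦ (hA' x).exists_sqrt (isInnerProduct_metric g x)
  refine ⟨S, fun x₀ ↦ ?_, hS, hSA⟩
  obtain ⟨b, hb, hb'⟩ := contMDiffAt_bilinear_iff.1 (g.contMDiff x₀)
  obtain ⟨a, ha, ha'⟩ := contMDiffAt_endomorphism_iff.1 (hA x₀)
  have key : ∀ᶠ x in 𝓝 x₀, IsInnerProduct (b x) ∧ IsPositiveOperator (b x) (a x) := by
    filter_upwards [hb', ha', eventually_tangentCoord_equiv (I := I) x₀] with x h1 h2 ⟨e, he⟩
    simp only [← he] at h1 h2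
    exact ⟨(isInnerProduct_metric g x).of_equiv e h1, (hA' x).of_equiv e h1 h2⟩
  obtain ⟨Φ, hΦ, hΦ'⟩ := exists_contDiffAt_sqrt_form key.self_of_nhds.1 key.self_of_nhds.2
  have hba : ContMDiffAt I 𝓘(ℝ, (E →L[ℝ] E →L[ℝ] ℝ) × (E →L[ℝ] E)) ∞ (fun x ↦ (b x, a x)) x₀ :=
    hb.prodMk_space ha
  refine contMDiffAt_endomorphism_iff.2 ⟨fun x ↦ Φ (b x, a x),
    ContDiffAt.comp_contMDiffAt (g := Φ) hΦ hba, ?_⟩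
  filter_upwards [hba.continuousAt.eventually hΦ', key, hb', ha',
    eventually_tangentCoord_equiv (I := I) x₀] with x h1 ⟨h2, h3⟩ h4 h5 ⟨e, he⟩ v
  simp only [← he] at h4 h5 ⊢
  obtain ⟨h6, h7⟩ := h1 h2 h3
  let S' : E →L[ℝ] E := (e : _ →L[ℝ] E) ∘L S x ∘L (e.symm : E →L[ℝ] _)
  have hS' : ∀ v, e (S x v) = S' (e v) := fun v ↦ by simp [S']
  have : S' = Φ (b x, a x) := by
    refine ((hS x).of_equiv e h4 hS').eq_of_sq_eq h2 h6 fun v ↦ ?_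
    rw [h7]
    obtain ⟨v, rfl⟩ := e.surjective v
    rw [← hS', ← hS', hSA, h5]
  rw [hS', this]

end Coordinates

/-! ### Metric connections and parallel endomorphisms -/

section MetricConnections

variable {E : Type*} [NormedAddCommGroup E] [NormedSpace ℝ E]
  {H : Type*} [TopologicalSpace H] {I : ModelWithCorners ℝ E H}
  {M : Type*} [TopologicalSpace M] [ChartedSpace H M] [IsManifold I ∞ M]

theorem contMDiff_mvfderiv {f : M → ℝ} (hf : ContMDiff I 𝓘(ℝ, ℝ) ∞ f) :
    SmoothOneForm I fun x ↦ mvfderiv I f x := by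
  intro x₀
  refine contMDiffAt_oneForm_iff.2 ⟨_, (hf x₀).mfderiv_const (m := ∞) (by rfl), ?_⟩
  filter_upwards [eventually_tangentCoord_symmL (I := I) x₀] with x hx v
  have h1 : inTangentCoordinates I 𝓘(ℝ, ℝ) id f (mfderiv I 𝓘(ℝ, ℝ) f) x₀ x
      (tangentCoord I x₀ x v) =
    (trivializationAt ℝ (TangentSpace 𝓘(ℝ, ℝ)) (f x₀)).continuousLinearMapAt ℝ (f x)
      (mfderiv I 𝓘(ℝ, ℝ) f x ((trivializationAt E (TangentSpace I) x₀).symmL ℝ x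
        (tangentCoord I x₀ x v))) := rfl
  rw [h1, hx.1, TangentBundle.continuousLinearMapAt_model_space]
  rfl

theorem mdifferentiableAt_metric_apply (g : Metric I M) {X Y : ∀ x : M, TangentSpace I x} {x : M}
    (hX : MDifferentiableAt I (I.prod 𝓘(ℝ, E)) (fun x ↦ Bundle.TotalSpace.mk' E x (X x)) x)
    (hY : MDifferentiableAt I (I.prod 𝓘(ℝ, E)) (fun x ↦ Bundle.TotalSpace.mk' E x (Y x)) x) :
    MDifferentiableAt I 𝓘(ℝ, ℝ) (fun x ↦ g.inner x (X x) (Y x)) x := by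
  have : MDifferentiableAt I (I.prod 𝓘(ℝ)) (fun m ↦ Bundle.TotalSpace.mk' ℝ
      (E := Bundle.Trivial M ℝ) m (g.inner m (X m) (Y m))) x := by
    apply MDifferentiableAt.clm_bundle_apply₂ (F₁ := E) (F₂ := E) (b := fun m : M ↦ m)
    · exact g.contMDiff.mdifferentiableAt (by simp)
    · exact hX
    · exact hY
  rw [mdifferentiableAt_totalSpace] at this
  exact this.2

theorem mvfderiv_sum {ι : Type*} {s : Finset ι} {f : ι → M → ℝ} {x : M}
    (hf : ∀ i ∈ s, MDifferentiableAt I 𝓘(ℝ, ℝ) (f i) x) :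
    MDifferentiableAt I 𝓘(ℝ, ℝ) (∑ i ∈ s, f i) x ∧
      mvfderiv I (∑ i ∈ s, f i) x = ∑ i ∈ s, mvfderiv I (f i) x := by
  classical
  induction s using Finset.induction_on with
  | empty => exact ⟨mdifferentiableAt_const, by simp [mvfderiv_zero]⟩
  | insert a s ha ih =>
    obtain ⟨h1, h2⟩ := ih fun i hi ↦ hf i (Finset.mem_insert_of_mem hi)
    have h3 := hf a (Finset.mem_insert_self a s)
    rw [Finset.sum_insert ha, Finset.sum_insert ha, mvfderiv_add h3 h1, h2]
    exact ⟨h3.add h1, rfl⟩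

variable [FiniteDimensional ℝ E] [T2Space M] [SigmaCompactSpace M]

variable (I M) in
-- Local frames are cut off by a partition of unity. Spanning is stated dually, in the form that
-- makes the frame operator positive definite.
theorem exists_locallyFinite_spanning_fields :
    ∃ s : M × Fin (finrank ℝ E) → ∀ x : M, TangentSpace I x, (∀ j, SmoothVectorField I (s j)) ∧
      LocallyFinite (fun j ↦ {x | s j x ≠ 0}) ∧
      ∀ x (f : TangentSpace I x →L[ℝ] ℝ), (∀ j, f (s j x) = 0) → f = 0 := by
  let b := finBasis ℝ E
  let t := fun x : M ↦ trivializationAt E (TangentSpace I : M → Type _) x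
  obtain ⟨ρ, hρ⟩ := SmoothPartitionOfUnity.exists_isSubordinate I isClosed_univ
    (fun x : M ↦ (t x).baseSet) (fun x ↦ (t x).open_baseSet)
    (fun x _ ↦ Set.mem_iUnion_of_mem x (FiberBundle.mem_baseSet_trivializationAt' x))
  refine ⟨fun j x ↦ ρ j.1 x • (t j.1).localFrame b j.2 x, fun j ↦ ?_, fun x ↦ ?_, fun x f hf ↦ ?_⟩
  · exact ContMDiffOn.smul_section_of_tsupport (ρ j.1).contMDiff.contMDiffOn
      (t j.1).open_baseSet (hρ j.1) ((t j.1).contMDiffOn_localFrame_baseSet ∞ b j.2)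
  · obtain ⟨U, hU, hfin⟩ := ρ.locallyFinite x
    refine ⟨U, hU, (hfin.prod Set.finite_univ).subset ?_⟩
    rintro ⟨k, i⟩ ⟨y, hy, hyU⟩
    exact ⟨⟨y, left_ne_zero_of_smul hy, hyU⟩, Set.mem_univ i⟩
  · obtain ⟨k, hk⟩ : ∃ k, ρ k x ≠ 0 := by
      obtain ⟨k, hk⟩ := ρ.exists_pos_of_mem (Set.mem_univ x)
      exact ⟨k, hk.ne'⟩
    have hx : x ∈ (t k).baseSet := hρ k (subset_closure hk)
    have h1 : ∀ i, f ((t k).basisAt b hx i) = 0 := fun i ↦ by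
      have := hf (k, i)
      rw [map_smul, smul_eq_zero] at this
      simpa [hx] using this.resolve_left hk
    ext v
    exact LinearMap.congr_fun (((t k).basisAt b hx).ext (f₁ := f.toLinearMap) (f₂ := 0) h1) v

/-- Every Riemannian metric admits a locally finite smooth family of vector fields which is a
Parseval frame at each point. -/
theorem exists_parseval_fields (g : Metric I M) :
    ∃ t : M × Fin (finrank ℝ E) → ∀ x : M, TangentSpace I x, (∀ j, SmoothVectorField I (t j)) ∧
      LocallyFinite (fun j ↦ {x | t j x ≠ 0}) ∧
      ∀ x (T : Finset (M × Fin (finrank ℝ E))), (∀ j, t j x ≠ 0 → j ∈ T) →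
        ∀ v, ∑ j ∈ T, g.inner x v (t j x) • t j x = v := by
  obtain ⟨s, hs, hfin, hspan⟩ := exists_locallyFinite_spanning_fields I M
  -- `A` is the frame operator of `s`. The Parseval frame is `A^(-1/2) s`, with `S = A^(1/2)` and `Q
  -- = S⁻¹` below.
  let A : ∀ x : M, TangentSpace I x →L[ℝ] TangentSpace I x := fun x ↦
    ∑ᶠ j, (g.inner x (s j x)).smulRight (s j x)
  have hA : ∀ x (T : Finset (M × Fin (finrank ℝ E))), (∀ j, s j x ≠ 0 → j ∈ T) →
      ∀ v, A x v = ∑ j ∈ T, g.inner x v (s j x) • s j x := by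
    intro x T hT v
    have : A x = ∑ j ∈ T, (g.inner x (s j x)).smulRight (s j x) := by
      refine finsum_eq_sum_of_support_subset _ fun j hj ↦ hT j fun h0 ↦ hj ?_
      simp [h0]
    rw [this]
    simp [g.symm x v]
  have hfin' : ∀ x, {j | s j x ≠ 0}.Finite := fun x ↦ hfin.point_finite x
  have hAs : SmoothEndomorphismField I A := by
    refine ContMDiff.finsum_section_of_locallyFinite
      (hfin.subset fun j x hx h0 ↦ hx ?_)
      fun j ↦ contMDiff_oneForm_smulRight (contMDiff_metric_flat g (hs j)) (hs j)
    simp [h0]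
  have hAp : ∀ x, IsPositiveOperator (g.inner x) (A x) := by
    intro x
    have hT : ∀ j, s j x ≠ 0 → j ∈ (hfin' x).toFinset := fun j hj ↦ by simpa using hj
    have h1 : ∀ u v, g.inner x (A x u) v =
        ∑ j ∈ (hfin' x).toFinset, g.inner x u (s j x) * g.inner x v (s j x) := fun u v ↦ by
      rw [hA x _ hT, g.symm]
      simp
    refine ⟨fun u v ↦ ?_, fun v hv ↦ ?_⟩
    · rw [h1, g.symm, h1]
      simp only [mul_comm]
    · rw [h1]
      have : ∃ j, g.inner x v (s j x) ≠ 0 := by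
        by_contra! h0
        have := g.pos x v hv
        rw [hspan x _ h0] at this
        simp at this
      obtain ⟨j, hj⟩ := this
      refine Finset.sum_pos' (fun _ _ ↦ mul_self_nonneg _) ⟨j, hT j fun h0 ↦ hj ?_,
        mul_self_pos.2 hj⟩
      simp [h0]
  obtain ⟨S, hS, hSp, hSA⟩ := exists_smooth_sqrt g hAs hAp
  have hQ : ∀ x, ∃ Q : TangentSpace I x →L[ℝ] TangentSpace I x,
      (∀ v, S x (Q v) = v) ∧ ∀ v, Q (S x v) = v := fun x ↦ by
    let e := (LinearEquiv.ofInjectiveEndo (S x).toLinearMap (hSp x).injective)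
    exact ⟨LinearMap.toContinuousLinearMap e.symm.toLinearMap, e.apply_symm_apply,
      e.symm_apply_apply⟩
  choose Q hQ1 hQ2 using hQ
  have hQs : SmoothEndomorphismField I Q := contMDiff_endomorphism_inverse hS hQ1 hQ2
  have hQsymm : ∀ x u v, g.inner x (Q x u) v = g.inner x u (Q x v) := fun x u v ↦ by
    have := (hSp x).symm (Q x u) (Q x v)
    rw [hQ1, hQ1] at this
    exact this.symm
  have hQ0 : ∀ x j, Q x (s j x) ≠ 0 ↔ s j x ≠ 0 := fun x j ↦ by
    refine not_congr ⟨fun h ↦ ?_, fun h ↦ by simp [h]⟩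
    rw [← hQ1 x (s j x), h, map_zero]
  refine ⟨fun j x ↦ Q x (s j x), fun j ↦ contMDiff_endomorphism_apply hQs (hs j), ?_, ?_⟩
  · simpa only [hQ0] using hfin
  · intro x T hT v
    have h2 := hA x T (fun j hj ↦ hT j ((hQ0 x j).2 hj)) (Q x v)
    rw [← hSA, hQ1] at h2
    have h3 := congrArg (Q x) h2
    rw [hQ2, map_sum] at h3
    conv_rhs => rw [h3]
    exact Finset.sum_congr rfl fun j _ ↦ by rw [map_smul, hQsymm]

/-- Every Riemannian metric admits a smooth metric connection. -/
theorem exists_metric_connection (g : Metric I M) :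
    ∃ nabla : Connection I M, nabla.ContMDiffCovariantDerivative ∞ ∧
      ∀ (X Y : ∀ x : M, TangentSpace I x) (x : M) (v : TangentSpace I x),
        MDifferentiableAt I (I.prod 𝓘(ℝ, E)) (fun x ↦ Bundle.TotalSpace.mk' E x (X x)) x →
        MDifferentiableAt I (I.prod 𝓘(ℝ, E)) (fun x ↦ Bundle.TotalSpace.mk' E x (Y x)) x →
        mvfderiv I (fun p ↦ g.inner p (X p) (Y p)) x v =
          g.inner x (nabla X x v) (Y x) + g.inner x (X x) (nabla Y x v) := by
  obtain ⟨t, ht, hfin, hP⟩ := exists_parseval_fields g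
  -- The map `Y ↦ (g(Y, t_j))_j` embeds the tangent bundle isometrically in a trivial bundle; `D` is
  -- the flat derivative followed by the adjoint of this embedding.
  let D : (∀ x : M, TangentSpace I x) → ∀ x : M, TangentSpace I x →L[ℝ] TangentSpace I x :=
    fun Y x ↦ ∑ᶠ j, (mvfderiv I (fun p ↦ g.inner p (Y p) (t j p)) x).smulRight (t j x)
  have hD : ∀ Y x (T : Finset (M × Fin (finrank ℝ E))), (∀ j, t j x ≠ 0 → j ∈ T) →
      D Y x = ∑ j ∈ T, (mvfderiv I (fun p ↦ g.inner p (Y p) (t j p)) x).smulRight (t j x) := by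
    intro Y x T hT
    refine finsum_eq_sum_of_support_subset _ fun j hj ↦ hT j fun h0 ↦ hj ?_
    simp [h0]
  have hmd : ∀ j x, MDifferentiableAt I (I.prod 𝓘(ℝ, E))
      (fun x ↦ Bundle.TotalSpace.mk' E x (t j x)) x := fun j x ↦
    (ht j).mdifferentiableAt (by simp)
  have hT : ∀ x j, t j x ≠ 0 → j ∈ (hfin.point_finite x).toFinset := fun x j hj ↦ by
    simpa using hj
  have hcov : IsCovariantDerivativeOn E D Set.univ := by
    refine ⟨fun {σ σ' x} hσ hσ' _ ↦ ?_, fun {σ f x} hσ hf _ ↦ ?_⟩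
    · simp only [hD _ x _ (hT x)]
      rw [← Finset.sum_add_distrib]
      refine Finset.sum_congr rfl fun j _ ↦ ?_
      have h1 : (fun p ↦ g.inner p ((σ + σ') p) (t j p)) =
          (fun p ↦ g.inner p (σ p) (t j p)) + fun p ↦ g.inner p (σ' p) (t j p) := by
        ext p; simp
      rw [h1, mvfderiv_add (mdifferentiableAt_metric_apply g hσ (hmd j x))
        (mdifferentiableAt_metric_apply g hσ' (hmd j x))]
      ext v
      simp [add_smul]
    · simp only [hD _ x _ (hT x)]
      ext v
      -- The Parseval identity turns `∑ df(v) g(σ, t_j) t_j` into `df(v) σ`.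
      have h0 := hP x _ (hT x) (σ x)
      simp only [add_apply, sum_apply, smul_apply, ContinuousLinearMap.smulRight_apply]
      conv_rhs => rw [← h0]
      rw [Finset.smul_sum, Finset.smul_sum, ← Finset.sum_add_distrib]
      refine Finset.sum_congr rfl fun j _ ↦ ?_
      have h1 : (fun p ↦ g.inner p ((f • σ) p) (t j p)) =
          f * fun p ↦ g.inner p (σ p) (t j p) := by
        ext p; simp
      rw [h1, mvfderiv_mul hf (mdifferentiableAt_metric_apply g hσ (hmd j x))]
      simp [add_smul, smul_smul, mul_comm]
  refine ⟨⟨D, hcov⟩, ⟨⟨fun {σ} hσ ↦ ?_⟩⟩, fun X Y x v hX hY ↦ ?_⟩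
  · rw [contMDiffOn_univ] at hσ ⊢
    refine ContMDiff.finsum_section_of_locallyFinite
      (hfin.subset fun j x hx h0 ↦ hx ?_) fun j ↦ contMDiff_oneForm_smulRight
        (contMDiff_mvfderiv (contMDiff_metric_apply g hσ (ht j))) (ht j)
    simp [h0]
  -- One finite index set must serve a whole neighbourhood of `x`, so that `g(X, Y) = ∑ g(X, t_j)
  -- g(Y, t_j)` can be differentiated term by term.
  · obtain ⟨U, hU, hUfin⟩ := hfin x
    have hTU : ∀ y ∈ U, ∀ j, t j y ≠ 0 → j ∈ hUfin.toFinset := fun y hy j hj ↦ by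
      simpa using ⟨y, hj, hy⟩
    set T := hUfin.toFinset
    have hin : ∀ y ∈ U, ∀ u w, g.inner y u w =
        ∑ j ∈ T, g.inner y u (t j y) * g.inner y w (t j y) := fun y hy u w ↦ by
      conv_lhs => rw [← hP y T (hTU y hy) w]
      simp [mul_comm]
    have heq : (fun p ↦ g.inner p (X p) (Y p)) =ᶠ[𝓝 x] ∑ j ∈ T,
        ((fun p ↦ g.inner p (X p) (t j p)) * fun p ↦ g.inner p (Y p) (t j p)) := by
      filter_upwards [hU] with y hy
      rw [hin y hy]
      simp
    have h1 : mvfderiv I (fun p ↦ g.inner p (X p) (Y p)) x = mvfderiv I (∑ j ∈ T,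
        ((fun p ↦ g.inner p (X p) (t j p)) * fun p ↦ g.inner p (Y p) (t j p))) x := by
      simp only [mvfderiv, heq.mfderiv_eq]
      rfl
    have hXd := fun j ↦ mdifferentiableAt_metric_apply g hX (hmd j x)
    have hYd := fun j ↦ mdifferentiableAt_metric_apply g hY (hmd j x)
    have hx := mem_of_mem_nhds hU
    rw [h1, (mvfderiv_sum fun j _ ↦ (hXd j).mul (hYd j)).2]
    change _ = g.inner x (D X x v) (Y x) + g.inner x (X x) (D Y x v)
    rw [hD X x T (hTU x hx), hD Y x T (hTU x hx), g.symm x _ (Y x)]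
    simp only [sum_apply, ContinuousLinearMap.smulRight_apply, map_sum, map_smul, smul_eq_mul]
    rw [← Finset.sum_add_distrib]
    refine Finset.sum_congr rfl fun j _ ↦ ?_
    rw [mvfderiv_mul (hXd j) (hYd j)]
    simp
    ring

/-- A smooth skew-symmetric `φ` with `φ³ = -φ` is parallel for some smooth metric connection. -/
theorem exists_parallelizing_connection (g : Metric I M)
    {φ : ∀ x : M, TangentSpace I x →L[ℝ] TangentSpace I x} (hφ : SmoothEndomorphismField I φ)
    (hskew : IsSkewSymmetric g φ) (hcube : ∀ x v, φ x (φ x (φ x v)) = -φ x v) :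
    ∃ nabla : Connection I M, nabla.ContMDiffCovariantDerivative ∞ ∧ IsSelfDual g nabla ∧
      SatisfiesGaugeEquation nabla nabla φ := by
  obtain ⟨D, ⟨⟨hDs⟩⟩, hDg⟩ := exists_metric_connection g
  let φ2 : ∀ x : M, TangentSpace I x →L[ℝ] TangentSpace I x := fun x ↦ φ x ∘L φ x
  let P : ∀ x : M, TangentSpace I x →L[ℝ] TangentSpace I x := fun x ↦
    ContinuousLinearMap.id ℝ (TangentSpace I x) + φ2 x
  have hφ2 : SmoothEndomorphismField I φ2 := contMDiff_endomorphism_comp hφ hφ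
  have hP : SmoothEndomorphismField I P := ContMDiff.add_section contMDiff_endomorphism_id hφ2
  have hφ2a : ∀ x v, φ2 x v = φ x (φ x v) := fun x v ↦ rfl
  have hPa : ∀ x v, P x v = v + φ x (φ x v) := fun x v ↦ rfl
  have hmd : ∀ {θ : ∀ x : M, TangentSpace I x →L[ℝ] TangentSpace I x} {Y : ∀ x : M, TangentSpace I x}
      {x : M}, SmoothEndomorphismField I θ →
      MDifferentiableAt I (I.prod 𝓘(ℝ, E)) (fun x ↦ Bundle.TotalSpace.mk' E x (Y x)) x →
      MDifferentiableAt I (I.prod 𝓘(ℝ, E)) (fun x ↦ Bundle.TotalSpace.mk' E x (θ x (Y x))) x :=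
    fun hθ hY ↦ (ContMDiff.mdifferentiableAt hθ (by simp)).clm_bundle_apply hY
  -- Since `φ³ = -φ`, the maps `-φ²` and `P` are the projections to the image and the kernel of `φ`.
  -- On the image `φ⁻¹ = -φ`, so the first term averages `D` with its conjugate by `φ`. The Leibniz
  -- rule rests on `(φ⁴ - φ²)/2 + P² = 1`.
  let D' : (∀ x : M, TangentSpace I x) → ∀ x : M, TangentSpace I x →L[ℝ] TangentSpace I x :=
    fun Y x ↦ (1 / 2 : ℝ) • (φ2 x ∘L D (fun p ↦ φ2 p (Y p)) x - φ x ∘L D (fun p ↦ φ p (Y p)) x) +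
      P x ∘L D (fun p ↦ P p (Y p)) x
  have hD'a : ∀ Y x v, D' Y x v = (1 / 2 : ℝ) • (φ2 x (D (fun p ↦ φ2 p (Y p)) x v) -
      φ x (D (fun p ↦ φ p (Y p)) x v)) + P x (D (fun p ↦ P p (Y p)) x v) := fun Y x v ↦ rfl
  have hcov : IsCovariantDerivativeOn E D' Set.univ := by
    have hDu := D.isCovariantDerivativeOnUniv
    refine ⟨fun {σ σ' x} hσ hσ' _ ↦ ?_, fun {σ f x} hσ hf _ ↦ ?_⟩
    · have key : ∀ θ : ∀ x : M, TangentSpace I x →L[ℝ] TangentSpace I x,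
          SmoothEndomorphismField I θ → D (fun p ↦ θ p ((σ + σ') p)) x =
            D (fun p ↦ θ p (σ p)) x + D (fun p ↦ θ p (σ' p)) x := fun θ hθ ↦ by
        rw [← hDu.add (hmd hθ hσ) (hmd hθ hσ')]
        congr 1
        ext p
        simp
      ext v
      simp only [hD'a, key _ hφ, key _ hφ2, key _ hP, add_apply, map_add]
      module
    · have key : ∀ θ : ∀ x : M, TangentSpace I x →L[ℝ] TangentSpace I x,
          SmoothEndomorphismField I θ → D (fun p ↦ θ p ((f • σ) p)) x =
            f x • D (fun p ↦ θ p (σ p)) x + (mvfderiv I f x).smulRight (θ x (σ x)) := fun θ hθ ↦ by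
        rw [← hDu.leibniz (hmd hθ hσ) hf]
        congr 1
        ext p
        simp
      ext v
      simp only [hD'a, key _ hφ, key _ hφ2, key _ hP]
      simp only [hD'a, add_apply, map_add, smul_apply, map_smul,
        ContinuousLinearMap.smulRight_apply, hφ2a, hPa, hcube, map_neg]
      module
  refine ⟨⟨D', hcov⟩, ⟨⟨fun {σ} hσ ↦ ?_⟩⟩, fun X Y hX hY x v ↦ ?_, fun Y hY x v ↦ ?_⟩
  · rw [contMDiffOn_univ] at hσ ⊢
    have key : ∀ θ : ∀ x : M, TangentSpace I x →L[ℝ] TangentSpace I x,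
        SmoothEndomorphismField I θ →
          SmoothEndomorphismField I fun x ↦ θ x ∘L D (fun p ↦ θ p (σ p)) x := fun θ hθ ↦
      contMDiff_endomorphism_comp hθ (contMDiffOn_univ.1
        (hDs (contMDiff_endomorphism_apply hθ hσ).contMDiffOn))
    exact ContMDiff.add_section ((ContMDiff.sub_section (key _ hφ2) (key _ hφ)).const_smul_section)
      (key _ hP)
  · have hXd := hX.mdifferentiableAt (x := x) (by simp)
    have hYd := hY.mdifferentiableAt (x := x) (by simp)
    have hsk := hskew x
    have e1 := hDg _ _ x v (hmd hφ hXd) (hmd hφ hYd)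
    have e2 := hDg _ _ x v (hmd hφ2 hXd) (hmd hφ2 hYd)
    have e3 := hDg _ _ x v (hmd hP hXd) (hmd hP hYd)
    have d1 := mdifferentiableAt_metric_apply g (hmd hφ hXd) (hmd hφ hYd)
    have d2 := mdifferentiableAt_metric_apply g hXd hYd
    have f2 : (fun p ↦ g.inner p (φ2 p (X p)) (φ2 p (Y p))) =
        fun p ↦ g.inner p (φ p (X p)) (φ p (Y p)) := by
      ext p
      rw [hφ2a, hφ2a, hskew, hcube, map_neg, neg_neg]
    have f3 : (fun p ↦ g.inner p (P p (X p)) (P p (Y p))) =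
        (fun p ↦ g.inner p (X p) (Y p)) - fun p ↦ g.inner p (φ p (X p)) (φ p (Y p)) := by
      ext p
      simp only [hPa, map_add, add_apply, Pi.sub_apply]
      rw [hskew p (φ p (X p)), hskew p (φ p (X p)), hcube, hskew p (X p), hskew p (X p)]
      simp
    rw [f2] at e2
    rw [f3, mvfderiv_sub d2 d1] at e3
    -- Each half is differentiated differently: one as `g(φX, φY)`, the other as `g(φ²X, φ²Y)`,
    -- which is the same function. The remainder is `g(PX, PY)`. The three match the three terms of
    -- `D'`.
    have e4 : mvfderiv I (fun p ↦ g.inner p (X p) (Y p)) x v =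
        (1 / 2 : ℝ) * mvfderiv I (fun p ↦ g.inner p (φ p (X p)) (φ p (Y p))) x v +
        (1 / 2 : ℝ) * mvfderiv I (fun p ↦ g.inner p (φ p (X p)) (φ p (Y p))) x v +
        (mvfderiv I (fun p ↦ g.inner p (X p) (Y p)) -
          mvfderiv I (fun p ↦ g.inner p (φ p (X p)) (φ p (Y p)))) x v := by
      simp only [Pi.sub_apply, sub_apply]
      ring
    have e3' : (mvfderiv I (fun p ↦ g.inner p (X p) (Y p)) -
          mvfderiv I (fun p ↦ g.inner p (φ p (X p)) (φ p (Y p)))) x v = _ := e3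
    rw [e4, e3']
    nth_rewrite 1 [e1]
    rw [e2]
    change _ = g.inner x (D' X x v) (Y x) + g.inner x (X x) (D' Y x v)
    simp only [hD'a, hφ2a, hPa, map_add, map_sub, map_smul, add_apply, sub_apply, smul_apply,
      smul_eq_mul, hsk]
    ring
  · have hYd := hY.mdifferentiableAt (x := x) (by simp)
    change D' (fun p ↦ φ p (Y p)) x v = φ x (D' Y x v)
    have h1 : (fun p ↦ φ2 p (φ p (Y p))) = (-1 : ℝ) • fun p ↦ φ p (Y p) := by
      ext p; simp [hφ2a, hcube]
    have h2 : (fun p ↦ P p (φ p (Y p))) = 0 := by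
      ext p; simp [hPa, hcube]
    have h3 : D (fun p ↦ φ2 p (φ p (Y p))) x = (-1 : ℝ) • D (fun p ↦ φ p (Y p)) x := by
      rw [h1, D.isCovariantDerivativeOnUniv.smul_const _ (hmd hφ hYd)]
    have h4 : D (fun p ↦ φ p (φ p (Y p))) = D (fun p ↦ φ2 p (Y p)) := rfl
    simp only [hD'a]
    rw [h3, h2, h4, D.isCovariantDerivativeOnUniv.zero]
    simp only [map_add, map_smul, map_sub, hφ2a, hPa, hcube, smul_apply, zero_apply, map_zero]
    module

end MetricConnections

/-! ### The complex structure on `V × ℝ` of almost contact data -/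

section ContactComplex

variable {V : Type*} [AddCommGroup V] [Module ℝ V] [TopologicalSpace V] [IsTopologicalAddGroup V]
  [ContinuousSMul ℝ V]

/-- The endomorphism `(v, a) ↦ (φ v - a ξ, η v)` of `V × ℝ`. -/
def contactComplex (φ : V →L[ℝ] V) (ξ : V) (η : V →L[ℝ] ℝ) : V × ℝ →L[ℝ] V × ℝ :=
  ContinuousLinearMap.inl ℝ V ℝ ∘L (φ ∘L ContinuousLinearMap.fst ℝ V ℝ -
    (ContinuousLinearMap.snd ℝ V ℝ).smulRight ξ) +
  ContinuousLinearMap.inr ℝ V ℝ ∘L η ∘L ContinuousLinearMap.fst ℝ V ℝ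

@[simp]
theorem contactComplex_apply (φ : V →L[ℝ] V) (ξ : V) (η : V →L[ℝ] ℝ) (w : V × ℝ) :
    contactComplex φ ξ η w = (φ w.1 - w.2 • ξ, η w.1) := by
  ext <;> simp [contactComplex]

theorem contactComplex_sq {φ : V →L[ℝ] V} {ξ : V} {η : V →L[ℝ] ℝ}
    (h1 : ∀ v, φ (φ v) = -v + η v • ξ) (h2 : φ ξ = 0) (h3 : η ξ = 1) (h4 : ∀ v, η (φ v) = 0)
    (w : V × ℝ) : contactComplex φ ξ η (contactComplex φ ξ η w) = -w := by
  ext <;> simp [h1, h2, h3, h4]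

theorem contDiff_contactComplex {E : Type*} [NormedAddCommGroup E] [NormedSpace ℝ E] :
    ContDiff ℝ ∞ fun p : (E →L[ℝ] E) × E × (E →L[ℝ] ℝ) ↦ contactComplex p.1 p.2.1 p.2.2 := by
  unfold contactComplex
  have h1 : ContDiff ℝ ∞ fun p : (E →L[ℝ] E) × E × (E →L[ℝ] ℝ) ↦ p.2.1 :=
    contDiff_fst.comp contDiff_snd
  have h2 : ContDiff ℝ ∞ fun p : (E →L[ℝ] E) × E × (E →L[ℝ] ℝ) ↦ p.2.2 :=
    contDiff_snd.comp contDiff_snd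
  exact (contDiff_const.clm_comp ((contDiff_fst.clm_comp contDiff_const).sub
    (contDiff_const.smulRight h1))).add
      (contDiff_const.clm_comp (h2.clm_comp contDiff_const))

end ContactComplex

/-! ### The sign of `ξ` and the induced orientation -/

section Orientation

variable {V : Type*} [AddCommGroup V] [Module ℝ V] [FiniteDimensional ℝ V]

theorem det_prodMap_id (T : V →ₗ[ℝ] V) :
    LinearMap.det (T.prodMap (LinearMap.id : ℝ →ₗ[ℝ] ℝ)) = LinearMap.det T := by
  simp [LinearMap.det_prodMap]

theorem det_prodMap_neg_id :
    LinearMap.det ((LinearMap.id : V →ₗ[ℝ] V).prodMap (-LinearMap.id : ℝ →ₗ[ℝ] ℝ)) = -1 := by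
  simp [LinearMap.det_prodMap]

variable [TopologicalSpace V] [IsTopologicalAddGroup V] [ContinuousSMul ℝ V]

/-- The complex structure on `V × ℝ` defined by `φ`, `ξ`, `η` induces the same orientation as `J₀`,
up to the sign of `s`. -/
def IsOrientedBy (J₀ : V × ℝ →ₗ[ℝ] V × ℝ) (s : ℝ) (φ : V →L[ℝ] V) (ξ : V) (η : V →L[ℝ] ℝ) : Prop :=
  ∃ T : V × ℝ →ₗ[ℝ] V × ℝ, (∀ w, T (J₀ w) = contactComplex φ ξ η (T w)) ∧ 0 < s * LinearMap.det T

variable {J₀ : V × ℝ →ₗ[ℝ] V × ℝ} {s : ℝ} {φ : V →L[ℝ] V} {ξ : V} {η : V →L[ℝ] ℝ}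

/-- Some isomorphism intertwines the two complex structures. If its determinant has the wrong sign,
composing with the reflection of the factor `ℝ` corrects the sign and replaces `ξ`, `η` by their
negatives. -/
theorem isOrientedBy_or_neg (hJ₀ : ∀ w, J₀ (J₀ w) = -w) (hs : s ≠ 0)
    (hJ : ∀ w, contactComplex φ ξ η (contactComplex φ ξ η w) = -w) :
    IsOrientedBy J₀ s φ ξ η ∨ IsOrientedBy J₀ s φ (-ξ) (-η) := by
  obtain ⟨T, hT⟩ := exists_linearEquiv_intertwining (J' := (contactComplex φ ξ η).toLinearMap)
    hJ₀ hJ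
  have hdet : LinearMap.det T.toLinearMap ≠ 0 := T.isUnit_det'.ne_zero
  rcases (mul_ne_zero hs hdet).lt_or_gt with h | h
  · right
    refine ⟨(LinearMap.id.prodMap (-LinearMap.id)) ∘ₗ T.toLinearMap, fun w ↦ ?_, ?_⟩
    · have := hT w
      simp only [LinearMap.comp_apply, LinearEquiv.coe_coe, this]
      ext <;> simp
    · rw [LinearMap.det_comp, det_prodMap_neg_id]
      linarith
  · exact Or.inl ⟨T.toLinearMap, hT, h⟩

/-- With `R` the reflection of `ℝ`, the map `T⁻¹ R T₁` would commute with `J₀` and yet have negative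
determinant. -/
theorem not_isOrientedBy_and_neg (hJ₀ : ∀ w, J₀ (J₀ w) = -w) :
    ¬ (IsOrientedBy J₀ s φ ξ η ∧ IsOrientedBy J₀ s φ (-ξ) (-η)) := by
  rintro ⟨⟨T, hT, hT'⟩, ⟨T₁, hT₁, hT₁'⟩⟩
  have hdet : IsUnit (LinearMap.det T) := (right_ne_zero_of_mul hT'.ne').isUnit
  let e := LinearEquiv.ofIsUnitDet (f := T) (v := finBasis ℝ (V × ℝ)) (v' := finBasis ℝ (V × ℝ))
    (by simpa using hdet)
  have he : ∀ w, e w = T w := fun w ↦ rfl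
  let R : V × ℝ →ₗ[ℝ] V × ℝ := LinearMap.id.prodMap (-LinearMap.id)
  have h1 : 0 ≤ LinearMap.det (e.symm.toLinearMap ∘ₗ R ∘ₗ T₁) := by
    refine det_nonneg_of_commute hJ₀ fun w ↦ e.injective ?_
    rw [he (J₀ _), hT, ← he]
    simp only [LinearMap.comp_apply, LinearEquiv.coe_coe, e.apply_symm_apply, hT₁]
    ext <;> simp [R]
  have h2 : LinearMap.det (T ∘ₗ e.symm.toLinearMap ∘ₗ R ∘ₗ T₁) = -LinearMap.det T₁ := by
    have : T ∘ₗ e.symm.toLinearMap ∘ₗ R ∘ₗ T₁ = R ∘ₗ T₁ := by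
      refine LinearMap.ext fun w ↦ ?_
      exact e.apply_symm_apply _
    rw [this, LinearMap.det_comp, det_prodMap_neg_id]
    ring
  rw [LinearMap.det_comp] at h2
  have h3 : s * LinearMap.det T * LinearMap.det (e.symm.toLinearMap ∘ₗ R ∘ₗ T₁) < 0 := by
    rw [mul_assoc, h2]
    linarith
  have h4 := mul_nonneg hT'.le h1
  linarith

end Orientation

/-! ### Locally consistent choice of the sign -/

section SignSelection

variable {M : Type*} [TopologicalSpace M] {E : Type*} [NormedAddCommGroup E] [NormedSpace ℝ E]
  [FiniteDimensional ℝ E]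

/-- A consistent choice of unit kernel vectors, given a local orientation `o` of `M`. -/
theorem exists_sign_selection (φ : M → E →L[ℝ] E) (v : M → E) (B : M → E →L[ℝ] E →L[ℝ] ℝ)
    (h1 : ∀ x w, φ x (φ x w) = -w + B x (v x) w • v x) (h2 : ∀ x, φ x (v x) = 0)
    (h3 : ∀ x, B x (v x) (v x) = 1) (h4 : ∀ x w, B x (v x) (φ x w) = 0)
    (τ : M → M → E →L[ℝ] E) (o : M → ℝ)
    (ho : ∀ x₀, ∀ᶠ x in 𝓝 x₀, 0 < o x * o x₀ * LinearMap.det (τ x₀ x).toLinearMap)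
    (hcoord : ∀ x₀, ∃ (f : M → E →L[ℝ] E) (b : M → E →L[ℝ] E →L[ℝ] ℝ), ContinuousAt f x₀ ∧
      ContinuousAt b x₀ ∧ ∀ᶠ x in 𝓝 x₀, (∀ w, τ x₀ x (φ x w) = f x (τ x₀ x w)) ∧
        ∀ u w, B x u w = b x (τ x₀ x u) (τ x₀ x w)) :
    ∃ ξ : M → E, (∀ x, ξ x = v x ∨ ξ x = -v x) ∧
      ∀ (x₀ : M) (Z : M → E), Z x₀ = ξ x₀ → ContinuousAt (fun x ↦ τ x₀ x (Z x)) x₀ →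
        (∀ᶠ x in 𝓝 x₀, Z x = v x ∨ Z x = -v x) → ∀ᶠ x in 𝓝 x₀, Z x = ξ x := by
  rcases isEmpty_or_nonempty M with hM | ⟨⟨xs⟩⟩
  · exact ⟨v, fun x ↦ (hM.false x).elim, fun x ↦ (hM.false x).elim⟩
  have hsq : ∀ x w, contactComplex (φ x) (v x) (B x (v x))
      (contactComplex (φ x) (v x) (B x (v x)) w) = -w := fun x ↦
    contactComplex_sq (h1 x) (h2 x) (h3 x) (h4 x)
  -- The structure at an arbitrary point serves as the reference for all points, since every fibre
  -- is modelled on `E`.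
  set J₀ : E × ℝ →ₗ[ℝ] E × ℝ := (contactComplex (φ xs) (v xs) (B xs (v xs))).toLinearMap with hJ₀d
  have hJ₀ : ∀ w, J₀ (J₀ w) = -w := hsq xs
  have ho0 : ∀ x, o x ≠ 0 := fun x h0 ↦ by
    have := (ho x).self_of_nhds
    simp [h0] at this
  have hchoice : ∀ x, ∃ ξ, (ξ = v x ∨ ξ = -v x) ∧ IsOrientedBy J₀ (o x) (φ x) ξ (B x ξ) := by
    intro x
    rcases isOrientedBy_or_neg hJ₀ (ho0 x) (hsq x) with h | h
    · exact ⟨_, Or.inl rfl, h⟩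
    · exact ⟨_, Or.inr rfl, by rwa [map_neg]⟩
  choose ξ hξ hξ' using hchoice
  refine ⟨ξ, hξ, fun x₀ Z hZ0 hZc hZ ↦ ?_⟩
  -- Only one of the two signs can be oriented correctly, so a correctly oriented `Z` must coincide
  -- with `ξ`.
  suffices h : ∀ᶠ x in 𝓝 x₀, IsOrientedBy J₀ (o x) (φ x) (Z x) (B x (Z x)) by
    filter_upwards [h, hZ] with x hx hZx
    by_contra hne
    have hneg : Z x = -ξ x := by
      rcases hZx with h | h <;> rcases hξ x with h' | h' <;> simp_all
    rw [hneg, map_neg] at hx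
    exact not_isOrientedBy_and_neg hJ₀ ⟨hξ' x, hx⟩
  obtain ⟨f, b, hf, hb, hfb⟩ := hcoord x₀
  obtain ⟨T₀, hT₀, hT₀'⟩ := hξ' x₀
  let τ' : M → E × ℝ →ₗ[ℝ] E × ℝ := fun x ↦ (τ x₀ x).toLinearMap.prodMap LinearMap.id
  have hτ' : ∀ x, LinearMap.det (τ' x) = LinearMap.det (τ x₀ x).toLinearMap := fun x ↦
    det_prodMap_id _
  let Jc : M → E × ℝ →L[ℝ] E × ℝ := fun x ↦
    contactComplex (f x) (τ x₀ x (Z x)) (b x (τ x₀ x (Z x)))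
  have hJc : ContinuousAt Jc x₀ :=
    (contDiff_contactComplex (E := E)).continuous.continuousAt.comp
      (f := fun x ↦ (f x, τ x₀ x (Z x), b x (τ x₀ x (Z x))))
      (hf.prodMk (hZc.prodMk (hb.clm_apply hZc)))
  let T₁ : E × ℝ →L[ℝ] E × ℝ := LinearMap.toContinuousLinearMap (τ' x₀ ∘ₗ T₀)
  let J₁ : E × ℝ →L[ℝ] E × ℝ := LinearMap.toContinuousLinearMap J₀
  -- Averaging makes `Tc x` intertwine `J₀` with `Jc x`. At `x₀` the map `T₁` already does so and is
  -- unchanged; by continuity the determinant keeps its sign nearby.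
  let Tc : M → E × ℝ →L[ℝ] E × ℝ := fun x ↦ (1 / 2 : ℝ) • (T₁ - Jc x ∘L T₁ ∘L J₁)
  have hTc : ContinuousAt Tc x₀ := by
    have : ContinuousAt (fun x ↦ T₁ - Jc x ∘L (T₁ ∘L J₁)) x₀ :=
      continuousAt_const.sub (hJc.clm_comp continuousAt_const)
    exact this.const_smul (1 / 2 : ℝ)
  have hint : ∀ᶠ x in 𝓝 x₀, ∀ w, τ' x (contactComplex (φ x) (Z x) (B x (Z x)) w) =
      Jc x (τ' x w) := by
    filter_upwards [hfb] with x ⟨hx1, hx2⟩ w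
    ext <;> simp [τ', Jc, hx1, hx2]
  have hTc0 : Tc x₀ = T₁ := by
    refine ContinuousLinearMap.ext fun w ↦ ?_
    have h5 : Jc x₀ (T₁ (J₁ w)) = -T₁ w := by
      change Jc x₀ (τ' x₀ (T₀ (J₀ w))) = -τ' x₀ (T₀ w)
      rw [hT₀, ← hZ0, hint.self_of_nhds, ← hint.self_of_nhds, ← hint.self_of_nhds, hZ0, ← hT₀,
        ← hT₀, hJ₀, map_neg, map_neg]
    simp only [Tc, smul_apply, sub_apply, ContinuousLinearMap.comp_apply, h5]
    module
  have hdetT₁ : T₁.det = LinearMap.det (τ x₀ x₀).toLinearMap * LinearMap.det T₀ := by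
    rw [← hτ', ← LinearMap.det_comp]
    rfl
  have hpos : ∀ᶠ x in 𝓝 x₀, 0 < o x₀ * (Tc x).det := by
    have hc : ContinuousAt (fun x ↦ o x₀ * (Tc x).det) x₀ :=
      continuousAt_const.mul (ContinuousLinearMap.continuous_det.continuousAt.comp hTc)
    refine hc.eventually (lt_mem_nhds ?_)
    change 0 < o x₀ * (Tc x₀).det
    rw [hTc0, hdetT₁]
    have h5 := (ho x₀).self_of_nhds
    have h6 : 0 < o x₀ * o x₀ := mul_self_pos.2 (ho0 x₀)
    have h7 : 0 < LinearMap.det (τ x₀ x₀).toLinearMap := pos_of_mul_pos_right h5 h6.le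
    nlinarith [mul_pos h7 hT₀']
  have hsqc : ∀ᶠ x in 𝓝 x₀, ∀ w, contactComplex (φ x) (Z x) (B x (Z x))
      (contactComplex (φ x) (Z x) (B x (Z x)) w) = -w := by
    filter_upwards [hZ] with x hx w
    rcases hx with hx | hx <;> rw [hx]
    · exact hsq x w
    · rw [map_neg]
      refine contactComplex_sq ?_ ?_ ?_ ?_ w <;> simp [h1, h2, h3, h4]
  filter_upwards [hpos, hint, ho x₀, hsqc] with x hx1 hx2 hx3 hx4
  have hdet : IsUnit (LinearMap.det (τ' x)) := by
    rw [hτ']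
    exact (right_ne_zero_of_mul hx3.ne').isUnit
  let e := LinearEquiv.ofIsUnitDet (f := τ' x) (v := finBasis ℝ (E × ℝ)) (v' := finBasis ℝ (E × ℝ))
    (by simpa using hdet)
  have he : ∀ w, e w = τ' x w := fun w ↦ rfl
  have hcomp : ∀ w, Tc x (J₀ w) = Jc x (Tc x w) := by
    intro w
    obtain ⟨w', hw'⟩ := e.surjective (T₁ (J₁ w))
    have h5 : Jc x (Jc x (T₁ (J₁ w))) = -T₁ (J₁ w) := by
      rw [← hw', he, ← hx2, ← hx2, hx4, map_neg]
    have h6 : J₁ (J₁ w) = -w := hJ₀ w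
    change Tc x (J₁ w) = _
    simp only [Tc, smul_apply, sub_apply, ContinuousLinearMap.comp_apply, map_smul, map_sub, h5, h6,
      map_neg]
    module
  refine ⟨e.symm.toLinearMap ∘ₗ (Tc x).toLinearMap, fun w ↦ e.injective ?_, ?_⟩
  · rw [he (contactComplex _ _ _ _), hx2, ← he]
    simp [hcomp]
  -- The coordinate change from `x` to `x₀` contributes the determinant `d`, whose sign is that of
  -- `o x * o x₀`. This trades the sign `o x₀` for `o x`.
  · have h5 : (Tc x).det = LinearMap.det (τ' x) *
        LinearMap.det (e.symm.toLinearMap ∘ₗ (Tc x).toLinearMap) := by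
      rw [← LinearMap.det_comp]
      change LinearMap.det (Tc x).toLinearMap = _
      refine congrArg LinearMap.det (LinearMap.ext fun w ↦ ?_)
      exact (e.apply_symm_apply _).symm
    rw [h5, hτ'] at hx1
    set d := LinearMap.det (τ x₀ x).toLinearMap
    set t := LinearMap.det (e.symm.toLinearMap ∘ₗ (Tc x).toLinearMap)
    have h6 : 0 < (o x * t) * (o x₀ * d) ^ 2 := by
      have := mul_pos hx1 hx3
      nlinarith
    exact pos_of_mul_pos_left h6 (sq_nonneg _)

end SignSelection

/-! ### Polar decomposition and kernels of skew-symmetric fields -/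

section Polar

variable {E : Type*} [NormedAddCommGroup E] [NormedSpace ℝ E] [FiniteDimensional ℝ E]
  {H : Type*} [TopologicalSpace H] {I : ModelWithCorners ℝ E H}
  {M : Type*} [TopologicalSpace M] [ChartedSpace H M] [IsManifold I ∞ M]

/-- The polar decomposition of a smooth skew-symmetric field `θ`, where `P` is the orthogonal
projection to the kernel of `θ`. -/
theorem exists_smooth_polar (g : Metric I M)
    {θ P : ∀ x : M, TangentSpace I x →L[ℝ] TangentSpace I x} (hθ : SmoothEndomorphismField I θ)
    (hP : SmoothEndomorphismField I P) (hskew : IsSkewSymmetric g θ)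
    (hPsymm : ∀ x u v, g.inner x (P x u) v = g.inner x u (P x v))
    (hPP : ∀ x v, P x (P x v) = P x v) (hθP : ∀ x v, θ x (P x v) = 0)
    (hker : ∀ x v, θ x v = 0 → P x v = v) :
    ∃ φ : ∀ x : M, TangentSpace I x →L[ℝ] TangentSpace I x, SmoothEndomorphismField I φ ∧
      IsSkewSymmetric g φ ∧ (∀ x v, φ x (φ x v) = -v + P x v) ∧
      ∀ x v, θ x v = 0 → φ x v = 0 := by
  have hPθ : ∀ x v, P x (θ x v) = 0 := fun x v ↦ by
    refine (isInnerProduct_metric g x).eq_zero ?_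
    rw [hPsymm, hPP, hskew, hθP, map_zero, neg_zero]
  -- By skewness `-θ²` is `θ` composed with its adjoint; it is positive off `ker θ`, and `P`
  -- supplies positivity there. The polar part is `A^(-1/2) θ`.
  let A : ∀ x : M, TangentSpace I x →L[ℝ] TangentSpace I x := fun x ↦ P x - θ x ∘L θ x
  have hAv : ∀ x v, A x v = P x v - θ x (θ x v) := fun x v ↦ rfl
  have hA : SmoothEndomorphismField I A :=
    ContMDiff.sub_section hP (contMDiff_endomorphism_comp hθ hθ)
  have hAg : ∀ x u v, g.inner x (A x u) v = g.inner x (P x u) v + g.inner x (θ x u) (θ x v) :=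
    fun x u v ↦ by
      rw [hAv, map_sub, sub_apply, hskew x (θ x u)]
      ring
  have hAp : ∀ x, IsPositiveOperator (g.inner x) (A x) := by
    refine fun x ↦ ⟨fun u v ↦ ?_, fun v hv ↦ ?_⟩
    · rw [hAg, g.symm x u, hAg, hPsymm, g.symm x u, g.symm x (θ x u)]
    · have hnn : ∀ w, 0 ≤ g.inner x w w := fun w ↦ by
        rcases eq_or_ne w 0 with rfl | hw
        · simp
        · exact (g.pos x w hw).le
      have h1 : g.inner x (P x v) v = g.inner x (P x v) (P x v) := by
        rw [← hPsymm, hPP]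
      rw [hAg, h1]
      by_cases h0 : θ x v = 0
      · rw [hker x v h0, h0]
        simpa using g.pos x v hv
      · exact add_pos_of_nonneg_of_pos (hnn _) (g.pos x _ h0)
  obtain ⟨S, hS, hSp, hSA⟩ := exists_smooth_sqrt g hA hAp
  have hQ : ∀ x, ∃ Q : TangentSpace I x →L[ℝ] TangentSpace I x,
      (∀ v, S x (Q v) = v) ∧ ∀ v, Q (S x v) = v := fun x ↦ by
    let e := (LinearEquiv.ofInjectiveEndo (S x).toLinearMap (hSp x).injective)
    exact ⟨LinearMap.toContinuousLinearMap e.symm.toLinearMap, e.apply_symm_apply,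
      e.symm_apply_apply⟩
  choose Q hQ1 hQ2 using hQ
  have hQs : SmoothEndomorphismField I Q := contMDiff_endomorphism_inverse hS hQ1 hQ2
  have hQsymm : ∀ x u v, g.inner x (Q x u) v = g.inner x u (Q x v) := fun x u v ↦ by
    have := (hSp x).symm (Q x u) (Q x v)
    rw [hQ1, hQ1] at this
    exact this.symm
  have hθS : ∀ x v, θ x (S x v) = S x (θ x v) := fun x ↦
    (hSp x).commute_of_commute_sq (isInnerProduct_metric g x) fun v ↦ by
      rw [hSA, hSA, hAv, hAv, map_sub, hθP, hPθ]
  have hθQ : ∀ x v, θ x (Q x v) = Q x (θ x v) := fun x v ↦ by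
    rw [← hQ2 x (θ x (Q x v)), ← hθS, hQ1]
  refine ⟨fun x ↦ Q x ∘L θ x, contMDiff_endomorphism_comp hQs hθ, fun x u v ↦ ?_, fun x v ↦ ?_,
    fun x v hv ↦ ?_⟩
  · simp only [ContinuousLinearMap.comp_apply]
    rw [hQsymm, hskew, hθQ]
  · have h1 : θ x (θ x v) = S x (S x (-v + P x v)) := by
      rw [hSA, hAv, map_add, map_add, map_neg, map_neg, hPP, hθP, add_zero, map_neg]
      abel
    simp only [ContinuousLinearMap.comp_apply]
    rw [hθQ, h1, hQ2, hQ2]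
  · simp [hv]

/-- Unit vectors in the one-dimensional kernels of a skew-symmetric field extend smoothly. -/
theorem exists_smooth_kernel_section (g : Metric I M)
    {θ : ∀ x : M, TangentSpace I x →L[ℝ] TangentSpace I x} (hθ : SmoothEndomorphismField I θ)
    (hskew : IsSkewSymmetric g θ) (hex : ∀ x, ∃ k, k ≠ 0 ∧ θ x k = 0) {x₀ : M}
    {v₀ : TangentSpace I x₀} (hv₀ : θ x₀ v₀ = 0) (hv₀' : g.inner x₀ v₀ v₀ = 1)
    (hker : ∀ k, θ x₀ k = 0 → ∃ c : ℝ, k = c • v₀) :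
    ∃ Z : ∀ x : M, TangentSpace I x,
      ContMDiffAt I (I.prod 𝓘(ℝ, E)) ∞ (fun x ↦ Bundle.TotalSpace.mk' E x (Z x)) x₀ ∧
      Z x₀ = v₀ ∧ ∀ᶠ x in 𝓝 x₀, θ x (Z x) = 0 ∧ g.inner x (Z x) (Z x) = 1 := by
  obtain ⟨b, hb, hb'⟩ := contMDiffAt_bilinear_iff.1 (g.contMDiff x₀)
  obtain ⟨a, ha, ha'⟩ := contMDiffAt_endomorphism_iff.1 (hθ x₀)
  have key : ∀ᶠ x in 𝓝 x₀, ∃ e : TangentSpace I x ≃L[ℝ] E, (∀ v, e v = tangentCoord I x₀ x v) ∧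
      (∀ v, e (θ x v) = a x (e v)) ∧ ∀ v w, g.inner x v w = b x (e v) (e w) := by
    filter_upwards [hb', ha', eventually_tangentCoord_equiv (I := I) x₀] with x h1 h2 ⟨e, he⟩
    simp only [← he] at h1 h2
    exact ⟨e, he, h2, h1⟩
  have hsk : ∀ᶠ x in 𝓝 x₀, IsInnerProduct (b x) ∧ (∀ u v, b x (a x u) v = -b x u (a x v)) ∧
      ∃ k, k ≠ 0 ∧ a x k = 0 := by
    filter_upwards [key] with x ⟨e, he, h1, h2⟩
    refine ⟨(isInnerProduct_metric g x).of_equiv e h2, fun u v ↦ ?_, ?_⟩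
    · obtain ⟨u, rfl⟩ := e.surjective u
      obtain ⟨v, rfl⟩ := e.surjective v
      rw [← h1, ← h1, ← h2, ← h2, hskew]
    · obtain ⟨k, hk, hk'⟩ := hex x
      exact ⟨e k, by simpa using hk, by rw [← h1, hk', map_zero]⟩
  obtain ⟨e₀, he₀, h1, h2⟩ := key.self_of_nhds
  obtain ⟨ζ, hζ, hζ0, hζ'⟩ := exists_contDiffAt_kernel (B₀ := b x₀) (θ₀ := a x₀) (v₀ := e₀ v₀)
    hsk.self_of_nhds.2.1 (by rw [← h1, hv₀, map_zero]) (by rw [← h2, hv₀']) fun k hk ↦ by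
      obtain ⟨k, rfl⟩ := e₀.surjective k
      rw [← h1, map_eq_zero_iff e₀ e₀.injective] at hk
      obtain ⟨c, rfl⟩ := hker k hk
      exact ⟨c, map_smul _ _ _⟩
  have hba : ContMDiffAt I 𝓘(ℝ, (E →L[ℝ] E →L[ℝ] ℝ) × (E →L[ℝ] E)) ∞ (fun x ↦ (b x, a x)) x₀ :=
    hb.prodMk_space ha
  have hsymmL := eventually_tangentCoord_symmL (I := I) x₀
  let Z : ∀ x : M, TangentSpace I x := fun x ↦
    (trivializationAt E (TangentSpace I) x₀).symmL ℝ x (ζ (b x, a x))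
  have hZ : ∀ᶠ x in 𝓝 x₀, tangentCoord I x₀ x (Z x) = ζ (b x, a x) := by
    filter_upwards [hsymmL] with x hx using hx.2 _
  refine ⟨Z, contMDiffAt_vector_iff.2 ?_, ?_, ?_⟩
  · have h3 : ContMDiffAt I 𝓘(ℝ, E) ∞ (fun x ↦ ζ (b x, a x)) x₀ :=
      ContDiffAt.comp_contMDiffAt (g := ζ) (f := fun x ↦ (b x, a x)) hζ hba
    exact h3.congr_of_eventuallyEq hZ
  · refine e₀.injective ?_
    rw [he₀, hZ.self_of_nhds, hζ0]
  · filter_upwards [hba.continuousAt.eventually hζ', hsk, key, hZ]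
      with x hx1 ⟨h3, h4, h5⟩ ⟨e, he, h6, h7⟩ hx2
    rw [← he] at hx2
    obtain ⟨h8, h9⟩ := hx1 h3 h4 h5
    rw [← hx2] at h8 h9
    rw [h7, ← map_eq_zero_iff e e.injective, h6]
    exact ⟨h8, h9⟩

theorem eq_or_eq_neg_of_unit_smul {V : Type*} [AddCommGroup V] [Module ℝ V] [TopologicalSpace V]
    {B : V →L[ℝ] V →L[ℝ] ℝ} {u v : V} (hu : B u u = 1) (hv : B v v = 1) {c : ℝ} (h : u = c • v) :
    u = v ∨ u = -v := by
  subst h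
  simp only [map_smul, smul_apply, hv, smul_eq_mul, mul_one] at hu
  rcases mul_self_eq_one_iff.1 hu with rfl | rfl <;> simp

end Polar

/-! ### Orientability in terms of preferred charts -/

section Orientable

variable {d : ℕ} {M : Type*} [TopologicalSpace M] [ChartedSpace (EuclideanSpace ℝ (Fin d)) M]
    [IsManifold (𝓡 d) ∞ M]

theorem tangentCoord_eq_mfderiv {E : Type*} [NormedAddCommGroup E] [NormedSpace ℝ E]
    {H : Type*} [TopologicalSpace H] {I : ModelWithCorners ℝ E H}
    {M : Type*} [TopologicalSpace M] [ChartedSpace H M] [IsManifold I ∞ M] {x₀ x : M}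
    (hx : x ∈ (chartAt H x₀).source) :
    tangentCoord I x₀ x = mfderiv I 𝓘(ℝ, E) (extChartAt I x₀) x :=
  TangentBundle.continuousLinearMapAt_trivializationAt hx

theorem mfderiv_chart_eq_comp {e e' : OpenPartialHomeomorph M (EuclideanSpace ℝ (Fin d))}
    (he : e ∈ IsManifold.maximalAtlas (𝓡 d) ∞ M) (he' : e' ∈ IsManifold.maximalAtlas (𝓡 d) ∞ M)
    {x : M} (hx : x ∈ e.source) (hx' : x ∈ e'.source) :
    (mfderiv (𝓡 d) (𝓡 d) e' x : EuclideanSpace ℝ (Fin d) →L[ℝ] EuclideanSpace ℝ (Fin d)) =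
      fderiv ℝ (e' ∘ e.symm) (e x) ∘L mfderiv (𝓡 d) (𝓡 d) e x := by
  have h1 : MDifferentiableAt (𝓡 d) (𝓡 d) e x :=
    (contMDiffAt_of_mem_maximalAtlas he hx).mdifferentiableAt (by simp)
  have h2 : MDifferentiableAt (𝓡 d) (𝓡 d) (e' ∘ e.symm) (e x) := by
    refine MDifferentiableAt.comp (I' := 𝓡 d) (e x) ?_
      ((contMDiffAt_symm_of_mem_maximalAtlas he (e.map_source hx)).mdifferentiableAt (by simp))
    rw [e.left_inv hx]
    exact (contMDiffAt_of_mem_maximalAtlas he' hx').mdifferentiableAt (by simp)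
  have h3 : (e' : M → EuclideanSpace ℝ (Fin d)) =ᶠ[𝓝 x] (e' ∘ e.symm) ∘ e := by
    filter_upwards [e.open_source.mem_nhds hx] with y hy
    simp [e.left_inv hy]
  rw [h3.mfderiv_eq, mfderiv_comp x h2 h1, mfderiv_eq_fderiv]
  rfl

/-- An orientable manifold carries a local orientation `o` compatible with the coordinates. -/
theorem IsOrientable.exists_orientation (hM : IsOrientable d M) :
    ∃ o : M → ℝ, ∀ x₀, ∀ᶠ x in 𝓝 x₀, 0 < o x * o x₀ *
      LinearMap.det (M := EuclideanSpace ℝ (Fin d)) (tangentCoord (𝓡 d) x₀ x).toLinearMap := by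
  obtain ⟨A, hA, hcov, hpos⟩ := hM
  choose e he hex using hcov
  let D : M → M → EuclideanSpace ℝ (Fin d) →L[ℝ] EuclideanSpace ℝ (Fin d) := fun y x ↦
    mfderiv (𝓡 d) (𝓡 d) (e y) x
  -- The tangent space at `x` is modelled by the preferred chart at `x`, so this determinant
  -- compares that chart with an oriented chart around `x`.
  refine ⟨fun x ↦ (D x x).det, fun x₀ ↦ ?_⟩
  let c := chartAt (EuclideanSpace ℝ (Fin d)) x₀
  have hcA : c ∈ IsManifold.maximalAtlas (𝓡 d) ∞ M := IsManifold.chart_mem_maximalAtlas x₀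
  let τ : M → EuclideanSpace ℝ (Fin d) →L[ℝ] EuclideanSpace ℝ (Fin d) := fun x ↦
    tangentCoord (𝓡 d) x₀ x
  change ∀ᶠ x in 𝓝 x₀, 0 < (D x x).det * (D x₀ x₀).det * (τ x).det
  have hτ : ∀ x ∈ c.source, τ x = mfderiv (𝓡 d) (𝓡 d) c x := fun x hx ↦
    tangentCoord_eq_mfderiv hx
  let F : M → EuclideanSpace ℝ (Fin d) →L[ℝ] EuclideanSpace ℝ (Fin d) := fun x ↦
    fderiv ℝ (e x₀ ∘ c.symm) (c x)
  have hx₀ : x₀ ∈ c.source := mem_chart_source _ _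
  have hcs : ∀ᶠ x in 𝓝 x₀, x ∈ c.source := c.open_source.mem_nhds hx₀
  have hes : ∀ᶠ x in 𝓝 x₀, x ∈ (e x₀).source := (e x₀).open_source.mem_nhds (hex x₀)
  have hD : ∀ x ∈ c.source, x ∈ (e x₀).source → D x₀ x = F x ∘L τ x := fun x h1 h2 ↦ by
    rw [hτ x h1]
    exact mfderiv_chart_eq_comp hcA (hA (he x₀)) h1 h2
  have hdet : ∀ f f' : EuclideanSpace ℝ (Fin d) →L[ℝ] EuclideanSpace ℝ (Fin d),
      (f ∘L f').det = f.det * f'.det := fun f f' ↦ LinearMap.det_comp _ _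
  have hequiv : ∀ᶠ x in 𝓝 x₀,
      ∃ f : EuclideanSpace ℝ (Fin d) ≃L[ℝ] EuclideanSpace ℝ (Fin d), ∀ v, f v = τ x v :=
    eventually_tangentCoord_equiv (I := 𝓡 d) x₀
  have hτ0 : ∀ᶠ x in 𝓝 x₀, (τ x).det ≠ 0 := by
    filter_upwards [hequiv] with x ⟨f, hf⟩
    have : τ x = f := ContinuousLinearMap.ext fun v ↦ (hf v).symm
    rw [this]
    exact (LinearEquiv.isUnit_det' f.toLinearEquiv).ne_zero
  have hτ1 : (τ x₀).det = 1 := by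
    have : τ x₀ = ContinuousLinearMap.id ℝ _ := by
      refine ContinuousLinearMap.ext fun v ↦ ?_
      change tangentCoord (𝓡 d) x₀ x₀ v = v
      rw [tangentCoord, TangentBundle.continuousLinearMapAt_trivializationAt_eq_core hx₀]
      exact (tangentBundleCore (𝓡 d) M).coordChange_self _ _ hx₀ v
    rw [this]
    exact LinearMap.det_id
  have hF : ContinuousAt F x₀ := by
    have h1 : ContDiffAt ℝ ∞ (e x₀ ∘ c.symm) (c x₀) := by
      refine ContMDiffAt.contDiffAt (ContMDiffAt.comp (I' := 𝓡 d) (c x₀) ?_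
        (contMDiffAt_symm_of_mem_maximalAtlas hcA (c.map_source hx₀)))
      rw [c.left_inv hx₀]
      exact contMDiffAt_of_mem_maximalAtlas (hA (he x₀)) (hex x₀)
    exact (h1.fderiv_right (m := 0) (by simp)).continuousAt.comp (c.continuousAt hx₀)
  -- The Jacobian of one fixed oriented chart against the chart at `x₀` is continuous and nonzero at
  -- `x₀`, so its sign is locally constant.
  have hFpos : ∀ᶠ x in 𝓝 x₀, 0 < (F x).det * (F x₀).det := by
    have hc : ContinuousAt (fun x ↦ (F x).det * (F x₀).det) x₀ :=
      (ContinuousLinearMap.continuous_det.continuousAt.comp hF).mul continuousAt_const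
    refine hc.eventually (lt_mem_nhds (mul_self_pos.2 fun h0 ↦ ?_))
    have h1 : τ x₀ = fderiv ℝ (c ∘ (e x₀).symm) (e x₀ x₀) ∘L D x₀ x₀ := by
      rw [hτ x₀ hx₀]
      exact mfderiv_chart_eq_comp (hA (he x₀)) hcA (hex x₀) hx₀
    rw [h1, hD x₀ hx₀ (hex x₀), hdet, hdet, h0] at hτ1
    simp at hτ1
  filter_upwards [hcs, hes, hτ0, hFpos] with x h1 h2 h3 h4
  have h5 : D x x = fderiv ℝ (e x ∘ (e x₀).symm) (e x₀ x) ∘L D x₀ x :=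
    mfderiv_chart_eq_comp (hA (he x₀)) (hA (he x)) h2 (hex x)
  have h6 := hpos _ (he x₀) _ (he x) x ⟨h2, hex x⟩
  rw [h5, hD x₀ hx₀ (hex x₀), hD x h1 h2, hdet, hdet, hdet, hτ1, mul_one]
  have h7 : 0 < (τ x).det ^ 2 := by positivity
  calc 0 < (fderiv ℝ (e x ∘ (e x₀).symm) (e x₀ x)).det * ((F x).det * (F x₀).det) *
        (τ x).det ^ 2 := by positivity
    _ = _ := by ring

end Orientable

/-! ### Almost Hermitian structures and solutions of full rank -/

section AlmostHermitian

variable {E : Type*} [NormedAddCommGroup E] [NormedSpace ℝ E] [FiniteDimensional ℝ E]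
  {H : Type*} [TopologicalSpace H] {I : ModelWithCorners ℝ E H}
  {M : Type*} [TopologicalSpace M] [ChartedSpace H M] [IsManifold I ∞ M]

/-- Full rank means trivial kernel, so the polar part with `P = 0` is skew with square `-1`, hence
orthogonal. -/
theorem AdmitsSkewSelfDualGaugeSolution.nonempty_almostHermitianStructure
    (h : AdmitsSkewSelfDualGaugeSolution I M (finrank ℝ E)) :
    Nonempty (AlmostHermitianStructure I M) := by
  obtain ⟨g, -, θ, -, -, hθ, -, hskew, hrank⟩ := h
  have hinj : ∀ x v, θ x v = 0 → v = 0 := fun x v hv ↦ by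
    have h1 : LinearMap.range (θ x).toLinearMap = ⊤ :=
      Submodule.eq_top_of_finrank_eq (hrank x)
    exact (map_eq_zero_iff (θ x).toLinearMap (LinearMap.injective_iff_surjective.2
      (LinearMap.range_eq_top.1 h1))).1 hv
  obtain ⟨J, hJ, hJskew, hJJ, -⟩ := exists_smooth_polar g (P := fun x ↦ 0) hθ
    (fun x₀ ↦ contMDiffAt_endomorphism_iff.2 ⟨fun _ ↦ 0, contMDiffAt_const, by simp⟩) hskew (by simp) (by simp) (by simp)
    fun x v hv ↦ by rw [hinj x v hv, map_zero]
  refine ⟨⟨J, g, hJ, by simpa using hJJ, fun x v w ↦ ?_⟩⟩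
  rw [hJskew, hJJ]
  simp

variable [T2Space M] [SigmaCompactSpace M]

/-- An orthogonal `J` with `J² = -1` is skew and satisfies `J³ = -J`, so `J` itself can be made
parallel. -/
theorem AlmostHermitianStructure.admitsSkewSelfDualGaugeSolution
    (s : AlmostHermitianStructure I M) : AdmitsSkewSelfDualGaugeSolution I M (finrank ℝ E) := by
  have hskew : IsSkewSymmetric s.h s.J := fun x v w ↦ by
    rw [← s.hermitian x v (s.J x w), s.J_J]
    simp
  obtain ⟨D, h1, h2, h3⟩ := exists_parallelizing_connection s.h s.smooth_J hskew
    fun x v ↦ by rw [s.J_J]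
  refine ⟨s.h, D, s.J, h1, h2, s.smooth_J, h3, hskew, fun x ↦ ?_⟩
  have : LinearMap.range (s.J x).toLinearMap = ⊤ :=
    LinearMap.range_eq_top.2 fun v ↦ ⟨-s.J x v, by simp [s.J_J]⟩
  rw [this, finrank_top]
  rfl

end AlmostHermitian

/-! ### Identities of almost contact metric structures; `φ` as a gauge solution -/

section AlmostContact

variable {E : Type*} [NormedAddCommGroup E] [NormedSpace ℝ E] [FiniteDimensional ℝ E]
  {H : Type*} [TopologicalSpace H] {I : ModelWithCorners ℝ E H}
  {M : Type*} [TopologicalSpace M] [ChartedSpace H M] [IsManifold I ∞ M]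

namespace AlmostContactMetricStructure

variable (s : AlmostContactMetricStructure I M)

/-- From `φ²ξ = 0`, the axiom applied to `φξ` gives `φξ = cξ`; then `0 = φ²ξ = c²ξ`. -/
theorem φ_ξ (x : M) : s.φ x (s.ξ x) = 0 := by
  have h1 : s.φ x (s.φ x (s.ξ x)) = 0 := by rw [s.φ_φ, s.η_ξ]; simp
  have h2 := s.φ_φ x (s.φ x (s.ξ x))
  rw [h1, map_zero] at h2
  have h3 : s.φ x (s.ξ x) = s.η x (s.φ x (s.ξ x)) • s.ξ x := by
    rw [eq_comm, neg_add_eq_zero] at h2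
    exact h2
  set c := s.η x (s.φ x (s.ξ x))
  rw [h3, map_smul, h3, smul_smul] at h1
  have h4 := congrArg (s.η x) h1
  rw [map_smul, s.η_ξ, map_zero, smul_eq_mul, mul_one] at h4
  rw [h3, mul_self_eq_zero.1 h4, zero_smul]

theorem η_eq (x : M) (v : TangentSpace I x) : s.η x v = s.g.inner x v (s.ξ x) := by
  have h := s.adapted x v (s.ξ x)
  rw [s.φ_ξ, map_zero, s.η_ξ] at h
  linarith

/-- Compare the two evaluations of `φ³ v`, as `φ²(φ v)` and as `φ(φ² v)`. -/
theorem η_φ (x : M) (v : TangentSpace I x) : s.η x (s.φ x v) = 0 := by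
  have h1 := s.φ_φ x (s.φ x v)
  rw [s.φ_φ x v, map_add, map_neg, map_smul, s.φ_ξ, smul_zero, add_zero, left_eq_add] at h1
  have h2 := congrArg (s.η x) h1
  rwa [map_smul, s.η_ξ, map_zero, smul_eq_mul, mul_one] at h2

theorem isSkewSymmetric : IsSkewSymmetric s.g s.φ := fun x v w ↦ by
  have h := s.adapted x v (s.φ x w)
  rw [s.φ_φ, s.η_φ, map_add, map_neg, map_smul, ← s.η_eq, s.η_φ] at h
  simp only [smul_eq_mul, mul_zero] at h
  linarith

theorem finrank_range (x : M) :
    finrank ℝ (LinearMap.range (s.φ x).toLinearMap) + 1 = finrank ℝ E := by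
  have h1 := LinearMap.finrank_range_add_finrank_ker (s.φ x).toLinearMap
  have h2 : LinearMap.ker (s.φ x).toLinearMap = Submodule.span ℝ {s.ξ x} := by
    ext v
    rw [LinearMap.mem_ker, Submodule.mem_span_singleton]
    constructor
    · intro hv
      refine ⟨s.η x v, ?_⟩
      have h3 := s.φ_φ x v
      rw [show s.φ x v = 0 from hv, map_zero, eq_comm, neg_add_eq_zero] at h3
      exact h3.symm
    · rintro ⟨c, rfl⟩
      simp [s.φ_ξ]
  have h3 : s.ξ x ≠ 0 := fun h0 ↦ by
    have := s.η_ξ x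
    simp [h0] at this
  rw [h2, finrank_span_singleton h3] at h1
  exact h1

theorem admitsSkewSelfDualGaugeSolution [T2Space M] [SigmaCompactSpace M]
    (s : AlmostContactMetricStructure I M) {r : ℕ} (hr : r + 1 = finrank ℝ E) : AdmitsSkewSelfDualGaugeSolution I M r := by
  obtain ⟨D, h1, h2, h3⟩ := exists_parallelizing_connection s.g s.smooth_φ s.isSkewSymmetric
    fun x v ↦ by rw [s.φ_φ, s.η_φ]; simp
  refine ⟨s.g, D, s.φ, h1, h2, s.smooth_φ, h3, s.isSkewSymmetric, fun x ↦ ?_⟩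
  have := s.finrank_range x
  omega

end AlmostContactMetricStructure

end AlmostContact

/-! ### Almost contact structures from skew fields of corank one -/

section Orientable

theorem exists_unit_kernel_vector {V : Type*} [AddCommGroup V] [Module ℝ V] [TopologicalSpace V]
    [FiniteDimensional ℝ V] {B : V →L[ℝ] V →L[ℝ] ℝ} (hB : IsInnerProduct B) (θ : V →ₗ[ℝ] V)
    (h : finrank ℝ (LinearMap.range θ) + 1 = finrank ℝ V) :
    ∃ v, θ v = 0 ∧ B v v = 1 ∧ ∀ k, θ k = 0 → ∃ c : ℝ, k = c • v := by
  have h1 : finrank ℝ (LinearMap.ker θ) = 1 := by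
    have := LinearMap.finrank_range_add_finrank_ker θ
    omega
  obtain ⟨⟨k, hk⟩, hk0, hk'⟩ := finrank_eq_one_iff'.1 h1
  have hpos := hB.pos k fun h0 ↦ hk0 (by ext; exact h0)
  have hs := Real.sqrt_pos.2 hpos
  refine ⟨(√(B k k))⁻¹ • k, by rw [map_smul, hk, smul_zero], ?_, fun w hw ↦ ?_⟩
  · simp only [map_smul, smul_apply, smul_eq_mul]
    rw [← mul_assoc, ← mul_inv, Real.mul_self_sqrt hpos.le, inv_mul_cancel₀ hpos.ne']
  · obtain ⟨c, hc⟩ := hk' ⟨w, hw⟩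
    refine ⟨c * √(B k k), ?_⟩
    rw [smul_smul, mul_assoc, mul_inv_cancel₀ hs.ne', mul_one]
    exact (congrArg Subtype.val hc).symm

variable {d : ℕ} {M : Type*} [TopologicalSpace M] [ChartedSpace (EuclideanSpace ℝ (Fin d)) M]
    [IsManifold (𝓡 d) ∞ M]

/-- The common core of 1 → 2 and 3 → 2: `φ` is the polar part of `θ`, `ξ` the unit kernel field with
sign fixed by the orientation, and `η` its metric dual. -/
theorem nonempty_almostContactMetricStructure (hM : IsOrientable d M) {r : ℕ} (hr : r + 1 = d)
    (g : Metric (𝓡 d) M) {θ : ∀ x : M, TangentSpace (𝓡 d) x →L[ℝ] TangentSpace (𝓡 d) x}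
    (hθ : SmoothEndomorphismField (𝓡 d) θ) (hskew : IsSkewSymmetric g θ)
    (hrank : HasConstantRank θ r) : Nonempty (AlmostContactMetricStructure (𝓡 d) M) := by
  have hg := isInnerProduct_metric g
  choose v hv hv1 hvker using fun x ↦ exists_unit_kernel_vector (hg x) (θ x).toLinearMap
    (by rw [hrank x, hr]; exact finrank_euclideanSpace_fin.symm)
  replace hv : ∀ x, θ x (v x) = 0 := hv
  replace hvker : ∀ x k, θ x k = 0 → ∃ c : ℝ, k = c • v x := hvker
  have hv0 : ∀ x, v x ≠ 0 := fun x h0 ↦ by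
    have := hv1 x
    simp [h0] at this
  have hex : ∀ x, ∃ k, k ≠ 0 ∧ θ x k = 0 := fun x ↦ ⟨v x, hv0 x, hv x⟩
  have hsec : ∀ x₀ (v₀ : TangentSpace (𝓡 d) x₀), (v₀ = v x₀ ∨ v₀ = -v x₀) →
      ∃ Z : ∀ x : M, TangentSpace (𝓡 d) x,
        ContMDiffAt (𝓡 d) ((𝓡 d).prod 𝓘(ℝ, EuclideanSpace ℝ (Fin d))) ∞
          (fun x ↦ Bundle.TotalSpace.mk' (EuclideanSpace ℝ (Fin d)) x (Z x)) x₀ ∧ Z x₀ = v₀ ∧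
        ∀ᶠ x in 𝓝 x₀, Z x = v x ∨ Z x = -v x := by
    intro x₀ v₀ hv₀
    obtain ⟨Z, hZ, hZ0, hZ'⟩ := exists_smooth_kernel_section g hθ hskew hex (x₀ := x₀) (v₀ := v₀)
      (by rcases hv₀ with rfl | rfl <;> simpa using hv x₀)
      (by rcases hv₀ with rfl | rfl <;> simpa using hv1 x₀)
      (fun k hk ↦ by
        obtain ⟨c, rfl⟩ := hvker x₀ k hk
        rcases hv₀ with rfl | rfl
        · exact ⟨c, rfl⟩
        · exact ⟨-c, by simp⟩)
    refine ⟨Z, hZ, hZ0, ?_⟩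
    filter_upwards [hZ'] with x ⟨h1, h2⟩
    obtain ⟨c, hc⟩ := hvker x _ h1
    exact eq_or_eq_neg_of_unit_smul h2 (hv1 x) hc
  -- The projection does not depend on the sign of `v x`, so it is smooth although `v` is an
  -- arbitrary choice.
  let P : ∀ x : M, TangentSpace (𝓡 d) x →L[ℝ] TangentSpace (𝓡 d) x := fun x ↦
    (g.inner x (v x)).smulRight (v x)
  have hPv : ∀ x w, P x w = g.inner x (v x) w • v x := fun x w ↦ rfl
  have hP : SmoothEndomorphismField (𝓡 d) P := fun x₀ ↦ by
    obtain ⟨Z, hZ, -, hZ'⟩ := hsec x₀ _ (Or.inl rfl)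
    refine (contMDiffAt_oneForm_smulRight (contMDiffAt_metric_flat g hZ) hZ).congr_of_eventuallyEq
      ?_
    filter_upwards [hZ'] with x hx
    have : P x = (g.inner x (Z x)).smulRight (Z x) := by
      ext1 w
      rcases hx with hx | hx <;> simp [hPv, hx]
    rw [this]
  obtain ⟨φ, hφ, hφskew, hφφ, hφ0⟩ := exists_smooth_polar g hθ hP hskew
    (fun x u w ↦ by simp only [hPv, map_smul, smul_apply, smul_eq_mul]; rw [g.symm x u]; ring)
    (fun x w ↦ by simp [hPv, hv1])
    (fun x w ↦ by rw [hPv, map_smul, hv, smul_zero])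
    (fun x w hw ↦ by
      obtain ⟨c, rfl⟩ := hvker x w hw
      simp [hPv, hv1])
  obtain ⟨o, ho⟩ := hM.exists_orientation
  have hφv : ∀ x, φ x (v x) = 0 := fun x ↦ hφ0 x _ (hv x)
  have hvφ : ∀ x w, g.inner x (v x) (φ x w) = 0 := fun x w ↦ by
    have := hφskew x (v x) w
    rw [hφv, map_zero, zero_apply] at this
    exact neg_eq_zero.1 this.symm
  obtain ⟨ξ, hξ, hξ'⟩ : ∃ ξ : ∀ x : M, TangentSpace (𝓡 d) x,
      (∀ x, ξ x = v x ∨ ξ x = -v x) ∧ ∀ (x₀ : M) (Z : ∀ x : M, TangentSpace (𝓡 d) x),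
        Z x₀ = ξ x₀ → ContinuousAt (fun x ↦ tangentCoord (𝓡 d) x₀ x (Z x)) x₀ →
        (∀ᶠ x in 𝓝 x₀, Z x = v x ∨ Z x = -v x) → ∀ᶠ x in 𝓝 x₀, Z x = ξ x :=
    exists_sign_selection (E := EuclideanSpace ℝ (Fin d)) (φ := φ) (v := v)
    (B := g.inner) hφφ hφv hv1
    hvφ (fun x₀ x ↦ tangentCoord (𝓡 d) x₀ x) o ho fun x₀ ↦ by
      obtain ⟨b, hb, hb'⟩ := contMDiffAt_bilinear_iff.1 (g.contMDiff x₀)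
      obtain ⟨a, ha, ha'⟩ := contMDiffAt_endomorphism_iff.1 (hφ x₀)
      exact ⟨a, b, ha.continuousAt, hb.continuousAt, ha'.and hb'⟩
  have hPξ : ∀ x w, P x w = g.inner x (ξ x) w • ξ x := fun x w ↦ by
    rcases hξ x with hx | hx <;> simp [hPv, hx]
  have hξs : SmoothVectorField (𝓡 d) ξ := fun x₀ ↦ by
    -- The smooth local section through `ξ x₀` agrees with `ξ` near `x₀` by the sign selection.
    obtain ⟨Z, hZ, hZ0, hZ'⟩ := hsec x₀ (ξ x₀) (hξ x₀)
    refine hZ.congr_of_eventuallyEq ?_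
    filter_upwards [hξ' x₀ Z hZ0 (contMDiffAt_vector_iff.1 hZ).continuousAt hZ'] with x hx
    rw [hx]
  refine ⟨⟨φ, ξ, fun x ↦ g.inner x (ξ x), g, hφ, hξs, contMDiff_metric_flat g hξs, fun x ↦ ?_,
    fun x w ↦ ?_, fun x u w ↦ ?_⟩⟩
  · rcases hξ x with hx | hx <;> simp [hv1, hx]
  · rw [hφφ, hPξ]
  · rw [hφskew, hφφ, hPξ, map_add, map_neg, map_smul, g.symm x u (ξ x)]
    simp only [smul_eq_mul]
    ring

end Orientable

/-! ### Pullbacks and products of inner products -/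

section Forms

variable {V W : Type*} [AddCommGroup V] [Module ℝ V] [TopologicalSpace V]
  [IsTopologicalAddGroup V] [ContinuousSMul ℝ V]
  [AddCommGroup W] [Module ℝ W] [TopologicalSpace W]
  [IsTopologicalAddGroup W] [ContinuousSMul ℝ W]

/-- The pullback of a bilinear form along two linear maps. -/
def pullbackForm (B : W →L[ℝ] W →L[ℝ] ℝ) (f f' : V →L[ℝ] W) : V →L[ℝ] V →L[ℝ] ℝ :=
  ContinuousLinearMap.precomp ℝ f' ∘L B ∘L f

@[simp]
theorem pullbackForm_apply (B : W →L[ℝ] W →L[ℝ] ℝ) (f f' : V →L[ℝ] W) (u v : V) :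
    pullbackForm B f f' u v = B (f u) (f' v) := rfl

/-- The product of a bilinear form with the standard form of `ℝ`. -/
def prodForm (B : V →L[ℝ] V →L[ℝ] ℝ) : V × ℝ →L[ℝ] V × ℝ →L[ℝ] ℝ :=
  pullbackForm B (.fst ℝ V ℝ) (.fst ℝ V ℝ) +
    pullbackForm (ContinuousLinearMap.mul ℝ ℝ) (.snd ℝ V ℝ) (.snd ℝ V ℝ)

@[simp]
theorem prodForm_apply (B : V →L[ℝ] V →L[ℝ] ℝ) (u v : V × ℝ) :
    prodForm B u v = B u.1 v.1 + u.2 * v.2 := rfl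

theorem IsInnerProduct.prodForm {B : V →L[ℝ] V →L[ℝ] ℝ} (hB : IsInnerProduct B) :
    IsInnerProduct (prodForm B) := by
  refine ⟨fun u v ↦ ?_, fun v hv ↦ ?_⟩
  · rw [prodForm_apply, prodForm_apply, hB.symm, mul_comm]
  · rw [prodForm_apply]
    by_cases h : v.1 = 0
    · have h2 : v.2 ≠ 0 := fun h2 ↦ hv (Prod.ext h h2)
      rw [h]
      simpa using h2
    · exact add_pos_of_pos_of_nonneg (hB.pos _ h) (mul_self_nonneg _)

theorem IsInnerProduct.pullbackForm {B : W →L[ℝ] W →L[ℝ] ℝ} (hB : IsInnerProduct B)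
    {f : V →L[ℝ] W} (hf : Function.Injective f) : IsInnerProduct (pullbackForm B f f) :=
  ⟨fun _ _ ↦ hB.symm _ _, fun _ hv ↦ hB.pos _ fun h ↦ hv (hf (h.trans (map_zero f).symm))⟩

theorem IsInnerProduct.exists_flat_equiv [FiniteDimensional ℝ V] [T2Space V]
    {B : V →L[ℝ] V →L[ℝ] ℝ}
    (hB : IsInnerProduct B) : ∃ e : V ≃ₗ[ℝ] (V →L[ℝ] ℝ), ∀ u, e u = B u := by
  have hinj : Function.Injective B.toLinearMap :=
    (injective_iff_map_eq_zero _).2 fun v hv ↦ hB.eq_zero (by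
      change B v = 0 at hv
      simp [hv])
  have h1 : finrank ℝ V = finrank ℝ (V →L[ℝ] ℝ) := by
    rw [← (LinearMap.toContinuousLinearMap (𝕜 := ℝ) (E := V) (F' := ℝ)).finrank_eq]
    exact Subspace.dual_finrank_eq.symm
  have : FiniteDimensional ℝ (V →L[ℝ] ℝ) :=
    (LinearMap.toContinuousLinearMap (𝕜 := ℝ) (E := V) (F' := ℝ)).finiteDimensional
  exact ⟨LinearEquiv.ofInjectiveOfFinrankEq _ hinj h1, fun u ↦ rfl⟩

end Forms

/-! ### Raising an index -/

section Sharp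

variable {E : Type*} [NormedAddCommGroup E] [NormedSpace ℝ E] [FiniteDimensional ℝ E]
  {H : Type*} [TopologicalSpace H] {I : ModelWithCorners ℝ E H}
  {M : Type*} [TopologicalSpace M] [ChartedSpace H M] [IsManifold I ∞ M]

/-- A smooth bilinear form is represented by a smooth field of endomorphisms. -/
theorem exists_smooth_sharp (g : Metric I M)
    {β : ∀ x : M, TangentSpace I x →L[ℝ] TangentSpace I x →L[ℝ] ℝ}
    (hβ : ContMDiff I (I.prod 𝓘(ℝ, E →L[ℝ] E →L[ℝ] ℝ)) ∞
      (fun x ↦ Bundle.TotalSpace.mk' (E →L[ℝ] E →L[ℝ] ℝ) x (β x))) :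
    ∃ θ : ∀ x : M, TangentSpace I x →L[ℝ] TangentSpace I x, SmoothEndomorphismField I θ ∧
      ∀ x u v, g.inner x (θ x u) v = β x u v := by
  choose f hf using fun x ↦ (isInnerProduct_metric g x).exists_flat_equiv
  let θ : ∀ x : M, TangentSpace I x →L[ℝ] TangentSpace I x := fun x ↦
    LinearMap.toContinuousLinearMap ((f x).symm.toLinearMap ∘ₗ (β x).toLinearMap)
  have hθ : ∀ x u v, g.inner x (θ x u) v = β x u v := fun x u v ↦ by
    rw [← hf]
    exact congrArg (fun φ : TangentSpace I x →L[ℝ] ℝ ↦ φ v) ((f x).apply_symm_apply (β x u))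
  refine ⟨θ, fun x₀ ↦ ?_, hθ⟩
  obtain ⟨b, hb, hb'⟩ := contMDiffAt_bilinear_iff.1 (g.contMDiff x₀)
  obtain ⟨c, hc, hc'⟩ := contMDiffAt_bilinear_iff.1 (hβ x₀)
  have key : ∀ᶠ x in 𝓝 x₀, ∃ F : E ≃L[ℝ] (E →L[ℝ] ℝ), (F : E →L[ℝ] (E →L[ℝ] ℝ)) = b x ∧
      ∀ v, tangentCoord I x₀ x (θ x v) = F.symm (c x (tangentCoord I x₀ x v)) := by
    filter_upwards [hb', hc', eventually_tangentCoord_equiv (I := I) x₀] with x h1 h2 ⟨e, he⟩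
    simp only [← he] at h1 h2
    obtain ⟨F, hF⟩ := ((isInnerProduct_metric g x).of_equiv e h1).exists_flat_equiv
    refine ⟨F.toContinuousLinearEquiv, ContinuousLinearMap.ext hF, fun v ↦ ?_⟩
    rw [ContinuousLinearEquiv.eq_symm_apply, ← he, ← he]
    refine (hF _).trans (ContinuousLinearMap.ext fun w ↦ ?_)
    obtain ⟨w, rfl⟩ := e.surjective w
    rw [← h1, ← h2, hθ]
  refine contMDiffAt_endomorphism_iff.2 ⟨fun x ↦ (b x).inverse ∘L c x, ?_, ?_⟩
  · obtain ⟨F, hF, -⟩ := key.self_of_nhds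
    have h1 : ContMDiffAt I 𝓘(ℝ, (E →L[ℝ] ℝ) →L[ℝ] E) ∞ (fun x ↦ (b x).inverse) x₀ := by
      refine ContDiffAt.comp_contMDiffAt (g := ContinuousLinearMap.inverse) ?_ hb
      rw [← hF]
      exact contDiffAt_map_inverse F
    exact h1.clm_comp hc
  · filter_upwards [key] with x ⟨F, hF, hF'⟩ v
    rw [hF', ← hF, ContinuousLinearMap.inverse_equiv]
    rfl

end Sharp

/-! ### The tangent bundle of `M × ℝ` -/

section Product

variable {E : Type*} [NormedAddCommGroup E] [NormedSpace ℝ E]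
  {H : Type*} [TopologicalSpace H] (I : ModelWithCorners ℝ E H)
  {M : Type*} [TopologicalSpace M] [ChartedSpace H M] [IsManifold I ∞ M]

/-- The tangent space of `M × ℝ` as a product. -/
def prodTangent (p : M × ℝ) : (TangentSpace I p.1 × ℝ) ≃L[ℝ] TangentSpace (I.prod 𝓘(ℝ, ℝ)) p :=
  ContinuousLinearEquiv.refl ℝ (E × ℝ)

/-- The preferred chart of the product is the product of the chart of `M` and the identity of `ℝ`,
so its derivative splits. -/
theorem eventually_tangentCoord_prod (p₀ : M × ℝ) : ∀ᶠ p in 𝓝 p₀, ∀ w : TangentSpace I p.1 × ℝ,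
    tangentCoord (I.prod 𝓘(ℝ, ℝ)) p₀ p (prodTangent I p w) =
      (tangentCoord I p₀.1 p.1 w.1, w.2) := by
  filter_upwards [(chartAt (ModelProd H ℝ) p₀).open_source.mem_nhds (mem_chart_source _ _)]
    with p hp w
  have hp1 : p.1 ∈ (chartAt H p₀.1).source := by
    rw [prodChartedSpace_chartAt] at hp
    exact hp.1
  have h1 : MDifferentiableAt I 𝓘(ℝ, E) (extChartAt I p₀.1) p.1 :=
    mdifferentiableAt_extChartAt hp1
  rw [tangentCoord_eq_mfderiv hp, tangentCoord_eq_mfderiv hp1]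
  have h2 : (extChartAt (I.prod 𝓘(ℝ, ℝ)) p₀ : M × ℝ → E × ℝ) =
      Prod.map (extChartAt I p₀.1) id := by
    rw [extChartAt_prod]
    rfl
  rw [h2, modelWithCornersSelf_prod, ← chartedSpaceSelf_prod,
    mfderiv_prodMap h1 mdifferentiableAt_id, mfderiv_id]
  rfl

end Product

/-! ### From almost contact on `M` to almost Hermitian on `M × ℝ` -/

section ContactToHermitian

variable {E : Type*} [NormedAddCommGroup E] [NormedSpace ℝ E] [FiniteDimensional ℝ E]
  {H : Type*} [TopologicalSpace H] {I : ModelWithCorners ℝ E H}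
  {M : Type*} [TopologicalSpace M] [ChartedSpace H M] [IsManifold I ∞ M]

theorem contDiff_pullbackForm {F : Type*} [NormedAddCommGroup F] [NormedSpace ℝ F]
    (f f' : F →L[ℝ] E) : ContDiff ℝ ∞ fun B : E →L[ℝ] E →L[ℝ] ℝ ↦ pullbackForm B f f' :=
  contDiff_const.clm_comp (contDiff_id.clm_comp contDiff_const)

theorem contDiff_prodForm : ContDiff ℝ ∞ fun B : E →L[ℝ] E →L[ℝ] ℝ ↦ prodForm B :=
  (contDiff_pullbackForm _ _).add contDiff_const

/-- The product of a Riemannian metric with the standard metric of the line. -/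
def prodMetric (g : Metric I M) : Metric (I.prod 𝓘(ℝ, ℝ)) (M × ℝ) :=
  metricOfInnerProduct
    (fun p ↦ pullbackForm (prodForm (g.inner p.1)) (prodTangent I p).symm.toContinuousLinearMap
      (prodTangent I p).symm.toContinuousLinearMap)
    (fun p ↦ (isInnerProduct_metric g p.1).prodForm.pullbackForm (prodTangent I p).symm.injective)
    (fun p₀ ↦ by
      obtain ⟨b, hb, hb'⟩ := contMDiffAt_bilinear_iff.1 (g.contMDiff p₀.1)
      refine contMDiffAt_bilinear_iff.2 ⟨fun p ↦ prodForm (b p.1), ?_, ?_⟩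
      · exact ContDiff.comp_contMDiffAt (g := prodForm) contDiff_prodForm
          (hb.comp p₀ contMDiffAt_fst)
      · filter_upwards [continuous_fst.continuousAt.eventually hb',
          eventually_tangentCoord_prod I p₀] with p h1 h2 v w
        obtain ⟨v, rfl⟩ := (prodTangent I p).surjective v
        obtain ⟨w, rfl⟩ := (prodTangent I p).surjective w
        rw [h2, h2]
        simp [h1])

theorem prodMetric_apply (g : Metric I M) (p : M × ℝ) (v w : TangentSpace I p.1 × ℝ) :
    (prodMetric g).inner p (prodTangent I p v) (prodTangent I p w) =
      g.inner p.1 v.1 w.1 + v.2 * w.2 := rfl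

/-- The almost Hermitian structure on `M × ℝ` defined by an almost contact metric structure. -/
def AlmostContactMetricStructure.almostHermitianStructure (s : AlmostContactMetricStructure I M) :
    AlmostHermitianStructure (I.prod 𝓘(ℝ, ℝ)) (M × ℝ) where
  J p := (prodTangent I p).toContinuousLinearMap ∘L
    contactComplex (s.φ p.1) (s.ξ p.1) (s.η p.1) ∘L (prodTangent I p).symm.toContinuousLinearMap
  h := prodMetric s.g
  smooth_J p₀ := by
    obtain ⟨a, ha, ha'⟩ := contMDiffAt_endomorphism_iff.1 (s.smooth_φ p₀.1)
    obtain ⟨c, hc, hc'⟩ := contMDiffAt_oneForm_iff.1 (s.smooth_η p₀.1)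
    have hξ := contMDiffAt_vector_iff.1 (s.smooth_ξ p₀.1)
    refine contMDiffAt_endomorphism_iff.2 ⟨fun p ↦ contactComplex (a p.1)
      (tangentCoord I p₀.1 p.1 (s.ξ p.1)) (c p.1), ?_, ?_⟩
    · have h1 : ContMDiffAt I 𝓘(ℝ, (E →L[ℝ] E) × E × (E →L[ℝ] ℝ)) ∞
          (fun x ↦ (a x, tangentCoord I p₀.1 x (s.ξ x), c x)) p₀.1 :=
        ha.prodMk_space (hξ.prodMk_space hc)
      have h2 := h1.comp p₀ (contMDiffAt_fst (I := I) (J := 𝓘(ℝ, ℝ)))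
      exact ContDiff.comp_contMDiffAt
        (g := fun q : (E →L[ℝ] E) × E × (E →L[ℝ] ℝ) ↦ contactComplex q.1 q.2.1 q.2.2)
        (f := fun p : M × ℝ ↦ (a p.1, tangentCoord I p₀.1 p.1 (s.ξ p.1), c p.1))
        contDiff_contactComplex h2
    · filter_upwards [continuous_fst.continuousAt.eventually ha',
        continuous_fst.continuousAt.eventually hc', eventually_tangentCoord_prod I p₀]
        with p h1 h2 h3 v
      obtain ⟨v, rfl⟩ := (prodTangent I p).surjective v
      simp [h3, h1, h2]
  J_J p v := by
    obtain ⟨v, rfl⟩ := (prodTangent I p).surjective v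
    simp only [ContinuousLinearMap.comp_apply, ContinuousLinearEquiv.coe_coe,
      ContinuousLinearEquiv.symm_apply_apply]
    rw [contactComplex_sq (s.φ_φ _) (s.φ_ξ _) (s.η_ξ _) (s.η_φ _), map_neg]
  hermitian p v w := by
    obtain ⟨v, rfl⟩ := (prodTangent I p).surjective v
    obtain ⟨w, rfl⟩ := (prodTangent I p).surjective w
    simp only [ContinuousLinearMap.comp_apply, ContinuousLinearEquiv.coe_coe,
      ContinuousLinearEquiv.symm_apply_apply, prodMetric_apply, contactComplex_apply]
    have h1 : ∀ u, s.g.inner p.1 (s.φ p.1 u) (s.ξ p.1) = 0 := fun u ↦ by rw [← s.η_eq, s.η_φ]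
    have h2 : ∀ u, s.g.inner p.1 (s.ξ p.1) (s.φ p.1 u) = 0 := fun u ↦ by rw [s.g.symm, h1]
    have h3 : s.g.inner p.1 (s.ξ p.1) (s.ξ p.1) = 1 := by rw [← s.η_eq, s.η_ξ]
    simp [h1, h2, h3, s.adapted]
    ring

end ContactToHermitian

/-! ### From almost Hermitian on `M × ℝ` to almost contact on `M` -/

section HermitianToContact

variable {V : Type*} [AddCommGroup V] [Module ℝ V] [TopologicalSpace V]
  [IsTopologicalAddGroup V] [ContinuousSMul ℝ V] [FiniteDimensional ℝ V] [T2Space V]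

/-- The tangential part of an orthogonal complex structure on `V × ℝ` has one-dimensional
kernel. -/
theorem finrank_range_of_complex {B : V × ℝ →L[ℝ] V × ℝ →L[ℝ] ℝ} (hB : IsInnerProduct B)
    {J : V × ℝ →L[ℝ] V × ℝ} (hJ : ∀ w, J (J w) = -w) (hJB : ∀ u w, B (J u) (J w) = B u w)
    {θ : V →ₗ[ℝ] V} (hθ : ∀ u v, B (θ u, 0) (v, 0) = B (J (u, 0)) (v, 0)) :
    finrank ℝ (LinearMap.range θ) + 1 = finrank ℝ V := by
  have hg : IsInnerProduct (pullbackForm B (.inl ℝ V ℝ) (.inl ℝ V ℝ)) :=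
    hB.pullbackForm LinearMap.inl_injective
  obtain ⟨f, hf⟩ := hg.exists_flat_equiv
  obtain ⟨Y, hY⟩ := f.surjective (B (0, 1) ∘L .inl ℝ V ℝ)
  have hY' : ∀ v, B (Y, 0) (v, 0) = B (0, 1) (v, 0) := fun v ↦ by
    have h1 : f Y v = B (0, 1) (v, 0) := by rw [hY]; rfl
    rw [← h1, hf]
    rfl
  -- `(Y, 0)` is the orthogonal projection of `(0, 1)` to `V`, so `ν` is normal to `V`; the two
  -- factors need not be orthogonal for `B`.
  let ν : V × ℝ := (-Y, 1)
  have hνv : ∀ v, B ν (v, 0) = 0 := fun v ↦ by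
    have : ν = (0, 1) - (Y, 0) := by simp [ν]
    rw [this, map_sub, sub_apply, hY', sub_self]
  have hν0 : ν ≠ 0 := fun h0 ↦ one_ne_zero (congrArg Prod.snd h0)
  have hskew : ∀ u w, B (J u) w = -B u (J w) := fun u w ↦ by
    rw [← hJB u (J w), hJ, map_neg, neg_neg]
  have hdecomp : ∀ w : V × ℝ, w = (w.1 + w.2 • Y, 0) + w.2 • ν := fun w ↦ by
    ext <;> simp [ν]
  have hJνν : B (J ν) ν = 0 := by
    have h1 := hskew ν ν
    rw [hB.symm ν] at h1
    linarith
  -- `J` is skew, so `J ν` is orthogonal to `ν` and hence tangent to `V`.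
  obtain ⟨k, hk⟩ : ∃ k : V, J ν = (k, 0) := by
    refine ⟨(J ν).1, Prod.ext rfl ?_⟩
    have h1 := hdecomp (J ν)
    have h2 := congrArg (fun w ↦ B ν w) h1
    simp only [map_add, map_smul, hνv, zero_add, smul_eq_mul] at h2
    rw [hB.symm, hJνν] at h2
    exact (mul_eq_zero.1 h2.symm).resolve_right (hB.pos ν hν0).ne'
  -- `θ u = 0` says that `J (u, 0)` is a multiple of `ν`, that is, `(u, 0)` is a multiple of `J ν`.
  have hker : LinearMap.ker θ = Submodule.span ℝ {k} := by
    ext u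
    rw [LinearMap.mem_ker, Submodule.mem_span_singleton]
    constructor
    · intro hu
      have h1 : ∀ v, B (J (u, 0)) (v, 0) = 0 := fun v ↦ by
        rw [← hθ, hu]
        change B 0 _ = 0
        simp
      have h2 := hdecomp (J (u, 0))
      set w := (J (u, 0)).1 + (J (u, 0)).2 • Y
      set a := (J (u, 0)).2
      have h3 : ((w, 0) : V × ℝ) = 0 := by
        refine hB.eq_zero ?_
        have := h1 w
        rw [h2, map_add, add_apply, map_smul, smul_apply, hνv, smul_zero, add_zero] at this
        exact this
      rw [h3, zero_add] at h2
      have h4 := congrArg J h2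
      rw [hJ, map_smul, hk] at h4
      refine ⟨-a, ?_⟩
      have h5 := congrArg Prod.fst h4
      simp only [Prod.fst_neg, Prod.smul_fst] at h5
      rw [neg_smul, ← h5, neg_neg]
    · rintro ⟨c, rfl⟩
      have h1 : θ k = 0 := by
        have h2 : ((θ k, 0) : V × ℝ) = 0 := by
          refine hB.eq_zero ?_
          rw [hθ, ← hk, hJ, map_neg, neg_apply, hνv, neg_zero]
        exact congrArg Prod.fst h2
      rw [map_smul, h1, smul_zero]
  have hk0 : k ≠ 0 := by
    rintro rfl
    have h1 := hJ ν
    rw [hk] at h1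
    refine hν0 (neg_eq_zero.1 (h1.symm.trans ?_))
    exact map_zero J
  rw [← LinearMap.finrank_range_add_finrank_ker θ, hker, finrank_span_singleton hk0]

variable {d : ℕ} {M : Type*} [TopologicalSpace M] [ChartedSpace (EuclideanSpace ℝ (Fin d)) M]
    [IsManifold (𝓡 d) ∞ M]

/-- On the slice `M × {0}` with the induced metric, the tangential part of `J` is a smooth skew
field of corank one, to which the corank-one construction applies. -/
theorem AlmostHermitianStructure.nonempty_almostContactMetricStructure
    (s : AlmostHermitianStructure ((𝓡 d).prod 𝓘(ℝ, ℝ)) (M × ℝ)) (hM : IsOrientable d M)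
    (hd : d ≠ 0) : Nonempty (AlmostContactMetricStructure (𝓡 d) M) := by
  let ι : M → M × ℝ := fun x ↦ (x, 0)
  have hι : ContMDiff (𝓡 d) ((𝓡 d).prod 𝓘(ℝ, ℝ)) ∞ ι := contMDiff_id.prodMk contMDiff_const
  let i : ∀ x : M, TangentSpace (𝓡 d) x →L[ℝ] TangentSpace ((𝓡 d).prod 𝓘(ℝ, ℝ)) (ι x) := fun x ↦
    (prodTangent (𝓡 d) (ι x)).toContinuousLinearMap ∘L .inl ℝ _ ℝ
  have hi : ∀ x, Function.Injective (i x) := fun x ↦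
    (prodTangent (𝓡 d) (ι x)).injective.comp LinearMap.inl_injective
  let i₀ := ContinuousLinearMap.inl ℝ (EuclideanSpace ℝ (Fin d)) ℝ
  have hiτ : ∀ x₀, ∀ᶠ x in 𝓝 x₀, ∀ v, tangentCoord ((𝓡 d).prod 𝓘(ℝ, ℝ)) (ι x₀) (ι x) (i x v) =
      i₀ (tangentCoord (𝓡 d) x₀ x v) := fun x₀ ↦ by
    filter_upwards [hι.continuous.continuousAt.eventually
      (eventually_tangentCoord_prod (𝓡 d) (ι x₀))] with x hx v
    exact hx _
  let g : Metric (𝓡 d) M := metricOfInnerProduct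
    (fun x ↦ pullbackForm (s.h.inner (ι x)) (i x) (i x))
    (fun x ↦ (isInnerProduct_metric s.h _).pullbackForm (hi x)) fun x₀ ↦ by
      obtain ⟨b, hb, hb'⟩ := contMDiffAt_bilinear_iff.1 (s.h.contMDiff (ι x₀))
      refine contMDiffAt_bilinear_iff.2 ⟨fun x ↦ pullbackForm (b (ι x)) i₀ i₀, ?_, ?_⟩
      · exact (contDiff_pullbackForm i₀ i₀).comp_contMDiffAt (hb.comp x₀ (hι x₀))
      · filter_upwards [hι.continuous.continuousAt.eventually hb', hiτ x₀] with x h1 h2 v w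
        simp [h1, h2]
  have hg : ∀ x u v, g.inner x u v = s.h.inner (ι x) (i x u) (i x v) := fun x u v ↦ rfl
  have hskew : ∀ p u w, s.h.inner p (s.J p u) w = -s.h.inner p u (s.J p w) := fun p u w ↦ by
    rw [← s.hermitian p u (s.J p w), s.J_J, map_neg, neg_neg]
  obtain ⟨θ, hθ, hθ'⟩ := exists_smooth_sharp g
    (β := fun x ↦ pullbackForm (s.h.inner (ι x)) (s.J (ι x) ∘L i x) (i x)) fun x₀ ↦ by
      obtain ⟨b, hb, hb'⟩ := contMDiffAt_bilinear_iff.1 (s.h.contMDiff (ι x₀))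
      obtain ⟨a, ha, ha'⟩ := contMDiffAt_endomorphism_iff.1 (s.smooth_J (ι x₀))
      refine contMDiffAt_bilinear_iff.2
        ⟨fun x ↦ pullbackForm (b (ι x) ∘L a (ι x)) i₀ i₀, ?_, ?_⟩
      · exact (contDiff_pullbackForm i₀ i₀).comp_contMDiffAt ((hb.clm_comp ha).comp x₀ (hι x₀))
      · filter_upwards [hι.continuous.continuousAt.eventually hb',
          hι.continuous.continuousAt.eventually ha', hiτ x₀] with x h1 h2 h3 v w
        simp [h1, h2, h3]
  obtain ⟨r, hr⟩ := Nat.exists_eq_add_one_of_ne_zero hd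
  refine GaugeGeometry.nonempty_almostContactMetricStructure hM (r := r) hr.symm g hθ (fun x u v ↦ ?_) fun x ↦ ?_
  · rw [hθ', g.symm x u, hθ', pullbackForm_apply, pullbackForm_apply]
    simp only [ContinuousLinearMap.comp_apply]
    rw [hskew, s.h.symm]
  · have h1 : finrank ℝ (LinearMap.range (θ x).toLinearMap) + 1 = d :=
      (finrank_range_of_complex (V := EuclideanSpace ℝ (Fin d))
        (isInnerProduct_metric s.h (ι x)) (J := s.J (ι x)) (s.J_J _) (s.hermitian _)
        (θ := (θ x).toLinearMap) (hθ' x)).trans finrank_euclideanSpace_fin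
    omega

end HermitianToContact

end GaugeGeometry

end

/-! ### The equivalences -/

theorem mainTheorem7 (n : ℕ) (M : Type*) [TopologicalSpace M] [T2Space M]
    [SecondCountableTopology M] [ChartedSpace (EuclideanSpace ℝ (Fin (2 * n + 1))) M]
    [IsManifold (𝓡 (2 * n + 1)) ∞ M] (hM : GaugeGeometry.IsOrientable (2 * n + 1) M) :
    List.TFAE [
      GaugeGeometry.AdmitsSkewSelfDualGaugeSolution (𝓡 (2 * n + 1)) M (2 * n),
      Nonempty (GaugeGeometry.AlmostContactMetricStructure (𝓡 (2 * n + 1)) M),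
      Nonempty (GaugeGeometry.AlmostHermitianStructure
        ((𝓡 (2 * n + 1)).prod 𝓘(ℝ, ℝ)) (M × ℝ)),
      GaugeGeometry.AdmitsSkewSelfDualGaugeSolution
        ((𝓡 (2 * n + 1)).prod 𝓘(ℝ, ℝ)) (M × ℝ) (2 * n + 2)] := by
  -- With second countability this makes `M` and `M × ℝ` σ-compact, as the partitions of unity
  -- behind metric connections require.
  have : LocallyCompactSpace M :=
    ChartedSpace.locallyCompactSpace (EuclideanSpace ℝ (Fin (2 * n + 1))) M
  have hd : Module.finrank ℝ (EuclideanSpace ℝ (Fin (2 * n + 1)) × ℝ) = 2 * n + 2 := by simp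
  tfae_have 1 → 2 := fun ⟨g, _, _, _, _, hθ, _, hskew, hrank⟩ ↦
    GaugeGeometry.nonempty_almostContactMetricStructure hM rfl g hθ hskew hrank
  tfae_have 2 → 1 := fun ⟨s⟩ ↦ s.admitsSkewSelfDualGaugeSolution (by simp)
  tfae_have 2 → 3 := fun ⟨s⟩ ↦ ⟨s.almostHermitianStructure⟩
  tfae_have 3 → 2 := fun ⟨s⟩ ↦ s.nonempty_almostContactMetricStructure hM (by simp)
  tfae_have 3 → 4 := fun ⟨s⟩ ↦ hd ▸ s.admitsSkewSelfDualGaugeSolution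
  tfae_have 4 → 3 := fun h ↦ by
    rw [← hd] at h
    exact h.nonempty_almostHermitianStructure
  tfae_finish
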